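/- Let $V$ be a finite-dimensional complex vector space, $p=\dim V$, and let $c\in S^3V^*$ be a cubic form, regarded as a symmetric trilinear form, such that the linear map $B:S^2V\to V^*$, $B(v_1,v_2)=c(v_1,v_2,\cdot)$, is surjective. Let $W$ be a complex vector space of dimension $2$ and $\omega\in\wedge^2W^*$ non-zero. Let $\mathfrak n=\mathfrak n_1\oplus\mathfrak n_2\oplus\mathfrak n_3$ with $\mathfrak n_1=V\otimes W$, $\mathfrak n_2=V^*$, $\mathfrak n_3=W$ be the graded nilpotent Lie algebra with brackets $$[v_1\otimes w_1,v_2\otimes w_2]=\omega(w_1,w_2)B(v_1,v_2),\qquad [f,v\otimes w]=f(v)w,$$ all other brackets of homogeneous elements, apart from those forced by antisymmetry, being zero; let $N$ be the simply connected nilpotent complex Lie group with Lie algebra $\mathfrak n$. For $\ell\in\mathbb PW$ let $\hat\ell\subset W$ be the corresponding line, $\mathfrak a_\ell=V\otimes\hat\ell\subset\mathfrak n_1$ and $A_\ell=\exp\mathfrak a_\ell\subset N$. Let $X_c$ be the $(2p+3)$-dimensional complex manifold formed by the quotients $N/A_\ell$, $\ell\in\mathbb PW$, with quotient map $\xi:N\times\mathbb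 PW\to X_c$ and projection $\psi:X_c\to\mathbb PW$. The group $G=N\rtimes SL(W)$ acts on $X_c$ by $(n,s)\cdot\xi(g,\ell)=\xi(n\,s(g),s\ell)$. Let $L=\psi^*\mathcal O_{\mathbb PW}(1)$. Fix $\ell\in\mathbb PW$ and put $x_\ell=\xi(o,\ell)$, where $o\in N$ is the identity, so that $T_{x_\ell}(X_c)=\mathfrak n_1/\mathfrak a_\ell\oplus\mathfrak n_2\oplus\mathfrak n_3\oplus T_\ell(\mathbb PW)$. Then $G$ acts on $X_c$ by holomorphic maps, there is exactly one $G$-invariant distribution $D\subset T(X_c)$ whose value at $x_\ell$ is $$D_{x_\ell}=\mathfrak n_1/\mathfrak a_\ell\oplus\mathfrak n_2\oplus\hat\ell\oplus T_\ell(\mathbb PW),$$ and this $D$ is a holomorphic contact structure on $X_c$: it is locally the kernel of a nowhere vanishing holomorphic $1$-form $\alpha$ such that $d\alpha$ is non-degenerate on $D$ at every point. Moreover $T(X_c)/D\cong L$ as holomorphic line bundles on $X_c$. -/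

import Mathlib

open scoped TensorProduct Manifold ContDiff LinearAlgebra.Projectivization Bundle

noncomputable section

/-! ### Complex manifolds glued from holomorphic parametrizations -/

/-- A family of injective parametrizations `param i : E → M` whose images cover `M` and whose
changes of coordinates are defined on open sets and holomorphic. -/
structure HolAtlas (ι E M : Type*) [NormedAddCommGroup E] [NormedSpace ℂ E] where
  param : ι → E → M
  param_injective : ∀ i, Function.Injective (param i)
  /-- a parametrization around a given point -/
  idx : M → ι
  mem_range : ∀ x, x ∈ Set.range (param (idx x))
  isOpen_overlap : ∀ i j, IsOpen (param i ⁻¹' Set.range (param j))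
  contDiffOn_change : ∀ i j, ContDiffOn ℂ ω (fun e => Function.invFun (param j) (param i e))
    (param i ⁻¹' Set.range (param j))

namespace HolAtlas

variable {ι E M : Type*} [NormedAddCommGroup E] [NormedSpace ℂ E] (A : HolAtlas ι E M)

/-- The chart inverse to the `i`-th parametrization. -/
def chart (i : ι) : PartialEquiv M E where
  toFun := Function.invFun (A.param i)
  invFun := A.param i
  source := Set.range (A.param i)
  target := Set.univ
  map_source' _ _ := Set.mem_univ _
  map_target' e _ := Set.mem_range_self e
  left_inv' _ hx := Function.invFun_eq hx
  right_inv' e _ := Function.leftInverse_invFun (A.param_injective i) e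

theorem overlap_source (i j : ι) : ((A.chart i).symm.trans (A.chart j)).source =
    A.param i ⁻¹' Set.range (A.param j) := by
  ext e
  simp [chart, PartialEquiv.trans_source]

/-- The charts of the atlas, as data generating a topology and a charted space structure. -/
def core : ChartedSpaceCore E M where
  atlas := Set.range A.chart
  chartAt x := A.chart (A.idx x)
  mem_chart_source x := A.mem_range x
  chart_mem_atlas x := ⟨_, rfl⟩
  open_source := by
    rintro _ _ ⟨i, rfl⟩ ⟨j, rfl⟩
    rw [overlap_source]
    exact A.isOpen_overlap i j
  continuousOn_toFun := by
    rintro _ _ ⟨i, rfl⟩ ⟨j, rfl⟩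
    rw [overlap_source]
    exact (A.contDiffOn_change i j).continuousOn

/-- The topology for which all charts are homeomorphisms onto open sets. -/
@[reducible] def topology : TopologicalSpace M := A.core.toTopologicalSpace

/-- The charted space structure given by the inverses of the parametrizations. -/
@[reducible] def chartedSpace : @ChartedSpace E _ M A.topology := A.core.toChartedSpace

theorem mem_atlas_iff (e : @OpenPartialHomeomorph M E A.topology _) :
    e ∈ @ChartedSpace.atlas E _ M A.topology A.chartedSpace ↔
      ∃ i, e = A.core.openPartialHomeomorph (A.chart i) ⟨i, rfl⟩ := by
  change e ∈ ⋃ (e : PartialEquiv M E) (he : e ∈ A.core.atlas),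
    {A.core.openPartialHomeomorph e he} ↔ _
  simp only [Set.mem_iUnion, Set.mem_singleton_iff]
  constructor
  · rintro ⟨_, ⟨i, rfl⟩, h⟩
    exact ⟨i, h⟩
  · rintro ⟨i, h⟩
    exact ⟨_, ⟨i, rfl⟩, h⟩

theorem isManifold : @IsManifold ℂ _ E _ _ E _ 𝓘(ℂ, E) ω M A.topology A.chartedSpace := by
  let := A.topology
  let := A.chartedSpace
  apply isManifold_of_contDiffOn
  intro e e' he he'
  obtain ⟨i, rfl⟩ := (A.mem_atlas_iff e).1 he
  obtain ⟨j, rfl⟩ := (A.mem_atlas_iff e').1 he'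
  refine (A.contDiffOn_change i j).mono ?_
  rw [← A.overlap_source]
  intro x hx
  exact hx.1

theorem contMDiff_param (i : ι) : @ContMDiff ℂ _ E _ _ E _ 𝓘(ℂ, E) E _ _ E _ _ E _ 𝓘(ℂ, E) M
    A.topology A.chartedSpace ω (A.param i) := by
  let := A.topology
  let := A.chartedSpace
  have := A.isManifold
  have h : A.core.openPartialHomeomorph (A.chart i) ⟨i, rfl⟩ ∈
      IsManifold.maximalAtlas 𝓘(ℂ, E) ω M :=
    IsManifold.subset_maximalAtlas ((A.mem_atlas_iff _).2 ⟨i, rfl⟩)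
  exact contMDiffOn_univ.1 (contMDiffOn_symm_of_mem_maximalAtlas h)

theorem contMDiffOn_chart (i : ι) : @ContMDiffOn ℂ _ E _ _ E _ 𝓘(ℂ, E) M A.topology A.chartedSpace
    E _ _ E _ 𝓘(ℂ, E) E _ _ ω (Function.invFun (A.param i)) (Set.range (A.param i)) := by
  let := A.topology
  let := A.chartedSpace
  have := A.isManifold
  have h : A.core.openPartialHomeomorph (A.chart i) ⟨i, rfl⟩ ∈
      IsManifold.maximalAtlas 𝓘(ℂ, E) ω M :=
    IsManifold.subset_maximalAtlas ((A.mem_atlas_iff _).2 ⟨i, rfl⟩)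
  exact contMDiffOn_of_mem_maximalAtlas h

theorem isOpen_range (i : ι) : @IsOpen M A.topology (Set.range (A.param i)) :=
  A.core.open_source' (e := A.chart i) ⟨i, rfl⟩

end HolAtlas

/-! ### Holomorphic contact structures -/

section Contact

variable {E M : Type*} [NormedAddCommGroup E] [NormedSpace ℂ E] [TopologicalSpace M]
  [ChartedSpace E M]

variable (E M) in
/-- A field of subspaces of the tangent spaces of a complex manifold. -/
abbrev TangentDistribution : Type _ := ∀ x : M, Submodule ℂ (TangentSpace 𝓘(ℂ, E) x)

variable (E M) in
/-- A (not necessarily holomorphic) field of complex linear 1-forms on a complex manifold. -/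
abbrev OneForm : Type _ := ∀ x : M, TangentSpace 𝓘(ℂ, E) x →L[ℂ] ℂ

namespace OneForm

/-- The expression of a 1-form in the chart at `x`. -/
def inChart (α : OneForm E M) (x : M) (p : E) : E →L[ℂ] ℂ :=
  (α ((chartAt E x).symm p)).comp (mfderiv 𝓘(ℂ, E) 𝓘(ℂ, E) (chartAt E x).symm p)

/-- The exterior derivative `dα(u, v)` at `x`, computed in the chart at `x`. -/
def extDerivAt (α : OneForm E M) (x : M) (u v : TangentSpace 𝓘(ℂ, E) x) : ℂ :=
  let p : E := chartAt E x x
  let u' : E := mfderiv 𝓘(ℂ, E) 𝓘(ℂ, E) (chartAt E x) x u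
  let v' : E := mfderiv 𝓘(ℂ, E) 𝓘(ℂ, E) (chartAt E x) x v
  fderiv ℂ (α.inChart x) p u' v' - fderiv ℂ (α.inChart x) p v' u'

/-- A 1-form is holomorphic on `U` if it is holomorphic as a function on the tangent bundle
over `U`. -/
def IsHolomorphicOn [IsManifold 𝓘(ℂ, E) ω M] (α : OneForm E M) (U : Set M) : Prop :=
  ContMDiffOn 𝓘(ℂ, E).tangent 𝓘(ℂ, ℂ) ω (fun v : TangentBundle 𝓘(ℂ, E) M => α v.proj v.2)
    {v | v.proj ∈ U}

end OneForm

/-- A holomorphic contact structure: a distribution of hyperplanes that is locally the kernel of a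
nowhere vanishing holomorphic 1-form `α` such that `dα` is non-degenerate on the hyperplanes. -/
def IsContactStructure [IsManifold 𝓘(ℂ, E) ω M] (D : TangentDistribution E M) : Prop :=
  ∀ x₀ : M, ∃ U : Set M, IsOpen U ∧ x₀ ∈ U ∧ ∃ α : OneForm E M, α.IsHolomorphicOn U ∧
    ∀ x ∈ U, α x ≠ 0 ∧ D x = LinearMap.ker (α x).toLinearMap ∧
      ∀ u ∈ D x, (∀ v ∈ D x, α.extDerivAt x u v = 0) → u = 0

end Contact

/-! ### The projective line -/

namespace ProjLine

variable {W : Type*} [NormedAddCommGroup W] [NormedSpace ℂ W]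

theorem vec_ne_zero (b : Module.Basis (Fin 2) ℂ W) (z : ℂ) : b 0 + z • b 1 ≠ 0 := by
  intro h
  have := congrArg (fun w => b.repr w 0) h
  simp at this

/-- The affine parametrization `z ↦ [b₀ + z b₁]` of the complement of the point `[b₁]`. -/
def param (b : Module.Basis (Fin 2) ℂ W) (z : ℂ) : ℙ ℂ W :=
  Projectivization.mk ℂ (b 0 + z • b 1) (vec_ne_zero b z)

theorem mk_mem_range_iff (b : Module.Basis (Fin 2) ℂ W) (w : W) (hw : w ≠ 0) :
    Projectivization.mk ℂ w hw ∈ Set.range (param b) ↔ b.repr w 0 ≠ 0 := by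
  constructor
  · rintro ⟨z, hz⟩ h0
    obtain ⟨a, ha⟩ := (Projectivization.mk_eq_mk_iff' ℂ _ _ _ _).1 hz
    have := congrArg (fun w => b.repr w 0) ha
    simp [h0] at this
  · intro h0
    refine ⟨b.repr w 1 / b.repr w 0, ?_⟩
    refine (Projectivization.mk_eq_mk_iff' ℂ _ _ _ _).2 ⟨(b.repr w 0)⁻¹, ?_⟩
    apply b.repr.injective
    ext i
    fin_cases i
    · simp [h0]
    · simp [div_eq_inv_mul]

theorem param_eq_mk (b : Module.Basis (Fin 2) ℂ W) (w : W) (hw : w ≠ 0) (h0 : b.repr w 0 ≠ 0) :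
    param b (b.repr w 1 / b.repr w 0) = Projectivization.mk ℂ w hw := by
  refine (Projectivization.mk_eq_mk_iff' ℂ _ _ _ _).2 ⟨(b.repr w 0)⁻¹, ?_⟩
  apply b.repr.injective
  ext i
  fin_cases i
  · simp [h0]
  · simp [div_eq_inv_mul]

theorem param_injective (b : Module.Basis (Fin 2) ℂ W) : Function.Injective (param b) := by
  intro z z' h
  obtain ⟨a, ha⟩ := (Projectivization.mk_eq_mk_iff' ℂ _ _ _ _).1 h
  have h0 := congrArg (fun w => b.repr w 0) ha
  have h1 := congrArg (fun w => b.repr w 1) ha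
  simp at h0 h1
  simpa [h0] using h1.symm

theorem exists_basis (hW : Module.finrank ℂ W = 2) (ℓ : ℙ ℂ W) :
    ∃ b : Module.Basis (Fin 2) ℂ W, ℓ ∈ Set.range (param b) := by
  have : FiniteDimensional ℂ W := FiniteDimensional.of_finrank_pos (by omega)
  let b := Module.finBasisOfFinrankEq ℂ W hW
  by_cases h : b.repr ℓ.rep 0 = 0
  · refine ⟨b.reindex (Equiv.swap 0 1), ?_⟩
    rw [← ℓ.mk_rep, mk_mem_range_iff]
    intro h1
    apply ℓ.rep_nonzero
    apply b.repr.injective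
    ext i
    fin_cases i
    · simpa using h
    · simpa using h1
  · refine ⟨b, ?_⟩
    rw [← ℓ.mk_rep, mk_mem_range_iff]
    exact h

theorem param_mem_range_iff (b b' : Module.Basis (Fin 2) ℂ W) (z : ℂ) :
    param b z ∈ Set.range (param b') ↔ b'.repr (b 0) 0 + z * b'.repr (b 1) 0 ≠ 0 := by
  rw [param, mk_mem_range_iff]
  simp

/-- The change of affine coordinate from `b` to `b'`. -/
def change (b b' : Module.Basis (Fin 2) ℂ W) (z : ℂ) : ℂ :=
  (b'.repr (b 0) 1 + z * b'.repr (b 1) 1) / (b'.repr (b 0) 0 + z * b'.repr (b 1) 0)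

theorem param_change (b b' : Module.Basis (Fin 2) ℂ W) (z : ℂ)
    (h : b'.repr (b 0) 0 + z * b'.repr (b 1) 0 ≠ 0) :
    param b' (change b b' z) = param b z := by
  have := param_eq_mk b' (b 0 + z • b 1) (vec_ne_zero b z) (by simpa using h)
  simpa [change, param] using this

theorem contDiffOn_change (b b' : Module.Basis (Fin 2) ℂ W) :
    ContDiffOn ℂ ω (change b b') {z | b'.repr (b 0) 0 + z * b'.repr (b 1) 0 ≠ 0} := by
  unfold change
  apply ContDiffOn.div
  · fun_prop
  · fun_prop
  · intro z hz
    exact hz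

/-- The atlas of the projective line `ℙ W` by affine coordinates. -/
def atlas (hW : Module.finrank ℂ W = 2) : HolAtlas (Module.Basis (Fin 2) ℂ W) ℂ (ℙ ℂ W) where
  param := param
  param_injective := param_injective
  idx ℓ := (exists_basis hW ℓ).choose
  mem_range ℓ := (exists_basis hW ℓ).choose_spec
  isOpen_overlap b b' := by
    have : param b ⁻¹' Set.range (param b') =
        {z | b'.repr (b 0) 0 + z * b'.repr (b 1) 0 ≠ 0} := by
      ext z
      exact param_mem_range_iff b b' z
    rw [this]
    exact isOpen_ne_fun (by fun_prop) continuous_const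
  contDiffOn_change b b' := by
    have : param b ⁻¹' Set.range (param b') =
        {z | b'.repr (b 0) 0 + z * b'.repr (b 1) 0 ≠ 0} := by
      ext z
      exact param_mem_range_iff b b' z
    rw [this]
    refine (contDiffOn_change b b').congr fun z hz => ?_
    rw [← param_change b b' z hz]
    exact Function.leftInverse_invFun (param_injective b') _

end ProjLine

set_option linter.unusedSectionVars false

/-! ### The Lie algebra, the nilpotent group and the homogeneous space of a cubic form -/

/-- A cubic form `c` on `V`, given as a symmetric trilinear form, together with a non-zero
alternating 2-form on `W`. -/
structure CubicData (V W : Type*) [AddCommGroup V] [Module ℂ V] [AddCommGroup W]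
    [Module ℂ W] where
  c : V →ₗ[ℂ] V →ₗ[ℂ] V →ₗ[ℂ] ℂ
  c_swap_left : ∀ u v w, c u v w = c v u w
  c_swap_right : ∀ u v w, c u v w = c u w v
  form : W →ₗ[ℂ] W →ₗ[ℂ] ℂ
  form_self : ∀ w, form w w = 0
  form_ne_zero : form ≠ 0

namespace CubicData

section Algebra

variable {V W : Type*} [AddCommGroup V] [Module ℂ V] [AddCommGroup W] [Module ℂ W]
  [Fact (Module.finrank ℂ W = 2)] (d : CubicData V W)

/-- `B(u, v) = c(u, v, ·)` with values in the dual of `V`. -/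
abbrev B : V →ₗ[ℂ] V →ₗ[ℂ] Module.Dual ℂ V := d.c

theorem B_symm (u v : V) : d.B u v = d.B v u := by
  ext w
  exact d.c_swap_left u v w

/-- The assumption that `B : S²V → V*` is surjective: the forms `B(u, v)` span the dual of `V`. -/
def BSurjective : Prop :=
  Submodule.span ℂ (Set.range fun p : V × V => d.B p.1 p.2) = ⊤

theorem form_swap (w w' : W) : d.form w w' = -d.form w' w := by
  have h := d.form_self (w + w')
  simp only [map_add, LinearMap.add_apply, d.form_self] at h
  linear_combination h

/-- In a plane, `ω(w₁, w₂) w₃ + ω(w₂, w₃) w₁ + ω(w₃, w₁) w₂ = 0`. -/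
theorem form_cyclic (w₁ w₂ w₃ : W) :
    d.form w₁ w₂ • w₃ + d.form w₂ w₃ • w₁ + d.form w₃ w₁ • w₂ = 0 := by
  have hW : Module.finrank ℂ W = 2 := Fact.out
  have : FiniteDimensional ℂ W := FiniteDimensional.of_finrank_pos (by omega)
  let b := Module.finBasisOfFinrankEq ℂ W hW
  have key : ∀ w, w = b.repr w 0 • b 0 + b.repr w 1 • b 1 := fun w => by
    rw [← Fin.sum_univ_two (fun i => b.repr w i • b i), b.sum_repr]
  have h10 : d.form (b 1) (b 0) = -d.form (b 0) (b 1) := d.form_swap _ _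
  have hf : ∀ w w', d.form w w' =
      (b.repr w 0 * b.repr w' 1 - b.repr w 1 * b.repr w' 0) * d.form (b 0) (b 1) := by
    intro w w'
    conv_lhs => rw [key w, key w']
    simp only [map_add, map_smul, LinearMap.add_apply, LinearMap.smul_apply, smul_eq_mul,
      d.form_self, h10]
    ring
  rw [hf w₁ w₂, hf w₂ w₃, hf w₃ w₁]
  apply b.repr.injective
  ext i
  fin_cases i <;> simp <;> ring

theorem form_map (s : SpecialLinearGroup ℂ W) (w w' : W) :
    d.form (s • w) (s • w') = d.form w w' := by
  have hW : Module.finrank ℂ W = 2 := Fact.out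
  have : FiniteDimensional ℂ W := FiniteDimensional.of_finrank_pos (by omega)
  let b := Module.finBasisOfFinrankEq ℂ W hW
  have key : ∀ w, w = b.repr w 0 • b 0 + b.repr w 1 • b 1 := fun w => by
    rw [← Fin.sum_univ_two (fun i => b.repr w i • b i), b.sum_repr]
  have h10 : d.form (b 1) (b 0) = -d.form (b 0) (b 1) := d.form_swap _ _
  have hf : ∀ w w', d.form w w' = d.form (b 0) (b 1) * b.det ![w, w'] := by
    intro w w'
    conv_lhs => rw [key w, key w']
    simp only [map_add, map_smul, LinearMap.add_apply, LinearMap.smul_apply, smul_eq_mul,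
      d.form_self, h10, Module.Basis.det_apply, Matrix.det_fin_two, Module.Basis.toMatrix_apply]
    simp
    ring
  have hdet := b.det_comp (s : W ≃ₗ[ℂ] W).toLinearMap ![w, w']
  have h1 : LinearMap.det (s : W ≃ₗ[ℂ] W).toLinearMap = 1 := by
    have h2 := congrArg Units.val s.2
    rwa [LinearEquiv.coe_det, Units.val_one] at h2
  rw [h1, one_mul] at hdet
  rw [hf, hf w w', ← hdet]
  congr 2
  ext i
  fin_cases i <;> rfl

/-- The graded vector space `𝔫 = 𝔫₁ ⊕ 𝔫₂ ⊕ 𝔫₃ = (V ⊗ W) ⊕ V* ⊕ W`. -/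
@[ext]
structure Nil (d : CubicData V W) where
  one : V ⊗[ℂ] W
  two : Module.Dual ℂ V
  three : W

namespace Nil

variable {d}

/-- The underlying triple. -/
def equivProd : d.Nil ≃ (V ⊗[ℂ] W) × Module.Dual ℂ V × W where
  toFun X := (X.one, X.two, X.three)
  invFun p := ⟨p.1, p.2.1, p.2.2⟩
  left_inv _ := rfl
  right_inv _ := rfl

instance : AddCommGroup d.Nil := equivProd.addCommGroup
instance : Module ℂ d.Nil := equivProd.module ℂ

@[simp] theorem add_one (X Y : d.Nil) : (X + Y).one = X.one + Y.one := rfl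
@[simp] theorem add_two (X Y : d.Nil) : (X + Y).two = X.two + Y.two := rfl
@[simp] theorem add_three (X Y : d.Nil) : (X + Y).three = X.three + Y.three := rfl
@[simp] theorem zero_one : (0 : d.Nil).one = 0 := rfl
@[simp] theorem zero_two : (0 : d.Nil).two = 0 := rfl
@[simp] theorem zero_three : (0 : d.Nil).three = 0 := rfl
@[simp] theorem neg_one (X : d.Nil) : (-X).one = -X.one := rfl
@[simp] theorem neg_two (X : d.Nil) : (-X).two = -X.two := rfl
@[simp] theorem neg_three (X : d.Nil) : (-X).three = -X.three := rfl
@[simp] theorem smul_one (t : ℂ) (X : d.Nil) : (t • X).one = t • X.one := rfl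
@[simp] theorem smul_two (t : ℂ) (X : d.Nil) : (t • X).two = t • X.two := rfl
@[simp] theorem smul_three (t : ℂ) (X : d.Nil) : (t • X).three = t • X.three := rfl

end Nil

/-- The bracket `𝔫₁ × 𝔫₁ → 𝔫₂`, `[v₁ ⊗ w₁, v₂ ⊗ w₂] = ω(w₁, w₂) B(v₁, v₂)`. -/
def bracketOne : V ⊗[ℂ] W →ₗ[ℂ] V ⊗[ℂ] W →ₗ[ℂ] Module.Dual ℂ V :=
  (TensorProduct.map₂ d.B d.form).compr₂ (TensorProduct.rid ℂ (Module.Dual ℂ V)).toLinearMap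

/-- The bracket `𝔫₂ × 𝔫₁ → 𝔫₃`, `[f, v ⊗ w] = f(v) w`. -/
def bracketTwo (_d : CubicData V W) : Module.Dual ℂ V →ₗ[ℂ] V ⊗[ℂ] W →ₗ[ℂ] W :=
  (LinearMap.rTensorHom W).compr₂ (TensorProduct.lid ℂ W).toLinearMap

@[simp] theorem bracketOne_tmul (v₁ v₂ : V) (w₁ w₂ : W) :
    d.bracketOne (v₁ ⊗ₜ w₁) (v₂ ⊗ₜ w₂) = d.form w₁ w₂ • d.B v₁ v₂ := by
  simp [bracketOne]

@[simp] theorem bracketTwo_tmul (f : Module.Dual ℂ V) (v : V) (w : W) :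
    d.bracketTwo f (v ⊗ₜ w) = f v • w := by
  simp [bracketTwo]

theorem bracketOne_swap (x y : V ⊗[ℂ] W) : d.bracketOne x y = -d.bracketOne y x := by
  induction x with
  | zero => simp
  | add x x' hx hx' => simp [hx, hx']; abel
  | tmul v w =>
    induction y with
    | zero => simp
    | add y y' hy hy' => simp [hy, hy']; abel
    | tmul v' w' =>
      rw [bracketOne_tmul, bracketOne_tmul, d.form_swap w w', d.B_symm v v', neg_smul]

theorem bracket_jacobi (x y z : V ⊗[ℂ] W) :
    d.bracketTwo (d.bracketOne x y) z + d.bracketTwo (d.bracketOne y z) x +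
      d.bracketTwo (d.bracketOne z x) y = 0 := by
  induction x with
  | zero => simp
  | add x x' hx hx' =>
    simp only [map_add, LinearMap.add_apply]
    have h := congrArg₂ (· + ·) hx hx'
    simp only [add_zero] at h
    rw [← h]
    abel
  | tmul v w =>
    induction y with
    | zero => simp
    | add y y' hy hy' =>
      simp only [map_add, LinearMap.add_apply]
      have h := congrArg₂ (· + ·) hy hy'
      simp only [add_zero] at h
      rw [← h]
      abel
    | tmul v' w' =>
      induction z with
      | zero => simp
      | add z z' hz hz' =>
        simp only [map_add, LinearMap.add_apply]
        have h := congrArg₂ (· + ·) hz hz'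
        simp only [add_zero] at h
        rw [← h]
        abel
      | tmul v'' w'' =>
        have h1 : d.c v' v'' v = d.c v v' v'' := by
          rw [d.c_swap_right, d.c_swap_left]
        have h2 : d.c v'' v v' = d.c v v' v'' := by
          rw [d.c_swap_left, d.c_swap_right]
        have := congrArg (fun u => d.c v v' v'' • u) (d.form_cyclic w w' w'')
        simp only [smul_add, smul_zero, smul_smul] at this
        simp only [bracketOne_tmul, map_smul, LinearMap.smul_apply, bracketTwo_tmul, smul_smul,
          h1, h2]
        rw [← this]
        module

namespace Nil

variable {d}

instance : Bracket d.Nil d.Nil where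
  bracket X Y := ⟨0, d.bracketOne X.one Y.one, d.bracketTwo X.two Y.one - d.bracketTwo Y.two X.one⟩

@[simp] theorem lie_one (X Y : d.Nil) : ⁅X, Y⁆.one = 0 := rfl
@[simp] theorem lie_two (X Y : d.Nil) : ⁅X, Y⁆.two = d.bracketOne X.one Y.one := rfl
@[simp] theorem lie_three (X Y : d.Nil) :
    ⁅X, Y⁆.three = d.bracketTwo X.two Y.one - d.bracketTwo Y.two X.one := rfl

instance : LieRing d.Nil where
  add_lie X Y Z := by ext1 <;> simp; abel
  lie_add X Y Z := by ext1 <;> simp; abel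
  lie_self X := by
    ext1
    · simp
    · have h := d.bracketOne_swap X.one X.one
      ext v
      exact self_eq_neg.1 (LinearMap.congr_fun h v)
    · simp
  leibniz_lie X Y Z := by
    ext1
    · simp
    · simp
    · have h := d.bracket_jacobi X.one Y.one Z.one
      rw [d.bracketOne_swap Z.one X.one] at h
      simp only [lie_three, add_three, lie_two, lie_one, map_zero, map_neg, LinearMap.neg_apply]
        at h ⊢
      refine sub_eq_zero.1 (Eq.trans ?_ (neg_eq_zero.2 h))
      abel

instance : LieAlgebra ℂ d.Nil where
  lie_smul t X Y := by ext1 <;> simp [smul_sub]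

/-- The Lie algebra `𝔫` is nilpotent of index three. -/
theorem lie_lie_lie (X Y Z U : d.Nil) : ⁅X, ⁅Y, ⁅Z, U⁆⁆⁆ = 0 := by
  ext1 <;> simp [-lie_lie]

theorem lie_lie_lie' (X Y Z U : d.Nil) : ⁅⁅X, Y⁆, ⁅Z, U⁆⁆ = 0 := by
  ext1 <;> simp [-lie_lie]

end Nil

theorem bracketOne_eq_zero (ℓ : ℙ ℂ W) {x y : V ⊗[ℂ] W}
    (hx : x ∈ LinearMap.range (LinearMap.lTensor V ℓ.submodule.subtype))
    (hy : y ∈ LinearMap.range (LinearMap.lTensor V ℓ.submodule.subtype)) :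
    d.bracketOne x y = 0 := by
  obtain ⟨x, rfl⟩ := hx
  obtain ⟨y, rfl⟩ := hy
  induction x with
  | zero => simp
  | add x x' hx hx' => simp only [map_add, LinearMap.add_apply, hx, hx', add_zero]
  | tmul v w =>
    induction y with
    | zero => simp
    | add y y' hy hy' => simp only [map_add, hy, hy', add_zero]
    | tmul v' w' =>
      obtain ⟨w, hw⟩ := w
      obtain ⟨w', hw'⟩ := w'
      rw [ℓ.submodule_eq, Submodule.mem_span_singleton] at hw hw'
      obtain ⟨t, rfl⟩ := hw
      obtain ⟨t', rfl⟩ := hw'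
      simp [d.form_self]

/-- The Baker–Campbell–Hausdorff product in the 3-step nilpotent Lie algebra `𝔫`. -/
def bch (X Y : d.Nil) : d.Nil :=
  X + Y + (1 / 2 : ℂ) • ⁅X, Y⁆ + (1 / 12 : ℂ) • ⁅X, ⁅X, Y⁆⁆ + (1 / 12 : ℂ) • ⁅Y, ⁅Y, X⁆⁆

/-- The simply connected nilpotent group `N` with Lie algebra `𝔫`: every element is `exp X` for a
unique `X : 𝔫`. -/
@[ext]
structure N (d : CubicData V W) where
  exp ::
  log : d.Nil

namespace N

variable {d}

instance : Mul d.N := ⟨fun g h => exp (d.bch g.log h.log)⟩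
instance : One d.N := ⟨exp 0⟩
instance : Inv d.N := ⟨fun g => exp (-g.log)⟩

theorem log_mul (g h : d.N) : (g * h).log = d.bch g.log h.log := rfl
@[simp] theorem log_one : (1 : d.N).log = 0 := rfl
@[simp] theorem log_inv (g : d.N) : (g⁻¹).log = -g.log := rfl

theorem log_mul_one (g h : d.N) : (g * h).log.one = g.log.one + h.log.one := by
  simp [log_mul, bch, -lie_lie]

theorem log_mul_two (g h : d.N) : (g * h).log.two =
    g.log.two + h.log.two + (1 / 2 : ℂ) • d.bracketOne g.log.one h.log.one := by
  simp [log_mul, bch, -lie_lie]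

theorem log_mul_three (g h : d.N) : (g * h).log.three = g.log.three + h.log.three +
    (1 / 2 : ℂ) • (d.bracketTwo g.log.two h.log.one - d.bracketTwo h.log.two g.log.one)
    - (1 / 12 : ℂ) • d.bracketTwo (d.bracketOne g.log.one h.log.one) g.log.one
    + (1 / 12 : ℂ) • d.bracketTwo (d.bracketOne g.log.one h.log.one) h.log.one := by
  rw [log_mul, bch]
  simp only [Nil.add_three, Nil.smul_three, Nil.lie_three, Nil.lie_two, Nil.lie_one, map_zero,
    zero_sub, d.bracketOne_swap h.log.one g.log.one, map_neg, neg_neg, LinearMap.neg_apply]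
  module

instance : Group d.N where
  mul_assoc a b c := by
    ext1
    ext1
    · simp only [log_mul_one, add_assoc]
    · simp only [log_mul_one, log_mul_two, map_add, LinearMap.add_apply]
      module
    · simp only [log_mul_one, log_mul_two, log_mul_three, map_add, LinearMap.add_apply, map_smul,
        LinearMap.smul_apply]
      have j := d.bracket_jacobi a.log.one b.log.one c.log.one
      rw [d.bracketOne_swap c.log.one a.log.one] at j
      simp only [map_neg, LinearMap.neg_apply] at j
      have j' : d.bracketTwo (d.bracketOne a.log.one c.log.one) b.log.one =
        d.bracketTwo (d.bracketOne a.log.one b.log.one) c.log.one +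
        d.bracketTwo (d.bracketOne b.log.one c.log.one) a.log.one := by
        rw [← sub_eq_zero, ← neg_eq_zero, ← j]
        abel
      rw [j']
      module
  one_mul a := by
    ext1
    simp [log_mul, bch]
  mul_one a := by
    ext1
    simp [log_mul, bch]
  inv_mul_cancel a := by
    ext1
    simp [log_mul, bch]

end N

/-- The abelian subgroup `A_ℓ = exp (V ⊗ ℓ̂)` of `N`. -/
def A (ℓ : ℙ ℂ W) : Subgroup d.N where
  carrier := {g | g.log.one ∈ LinearMap.range (LinearMap.lTensor V ℓ.submodule.subtype) ∧
    g.log.two = 0 ∧ g.log.three = 0}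
  one_mem' := ⟨zero_mem _, rfl, rfl⟩
  inv_mem' := by
    rintro g ⟨h1, h2, h3⟩
    exact ⟨by simpa using h1, by simp [h2], by simp [h3]⟩
  mul_mem' := by
    rintro g h ⟨g1, g2, g3⟩ ⟨h1, h2, h3⟩
    have hab : d.bracketOne g.log.one h.log.one = 0 := d.bracketOne_eq_zero ℓ g1 h1
    refine ⟨?_, ?_, ?_⟩
    · rw [N.log_mul_one]
      exact add_mem g1 h1
    · rw [N.log_mul_two, g2, h2, hab]
      simp
    · rw [N.log_mul_three, g2, h2, g3, h3, hab]
      simp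

/-- The homogeneous space `X_c`, the family of quotients `N / A_ℓ` for `ℓ` in `ℙ W`. -/
def X (d : CubicData V W) : Type _ := Σ ℓ : ℙ ℂ W, d.N ⧸ d.A ℓ

/-- The quotient map `ξ : N × ℙ W → X_c`. -/
def ξ (g : d.N) (ℓ : ℙ ℂ W) : d.X := ⟨ℓ, (g : d.N ⧸ d.A ℓ)⟩

theorem ξ_surj (x : d.X) : ∃ g ℓ, d.ξ g ℓ = x := by
  obtain ⟨ℓ, q⟩ := x
  obtain ⟨g, rfl⟩ := QuotientGroup.mk_surjective q
  exact ⟨g, ℓ, rfl⟩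

theorem ξ_eq_iff (g h : d.N) (ℓ m : ℙ ℂ W) :
    d.ξ g ℓ = d.ξ h m ↔ ℓ = m ∧ g⁻¹ * h ∈ d.A ℓ := by
  constructor
  · intro e
    have e1 : ℓ = m := congrArg Sigma.fst e
    subst e1
    exact ⟨rfl, QuotientGroup.eq.1 (eq_of_heq (Sigma.mk.inj e).2)⟩
  · rintro ⟨rfl, e⟩
    exact congrArg (Sigma.mk ℓ) (QuotientGroup.eq.2 e)

/-! #### The action of `G = N ⋊ SL(W)` -/

/-- The action of `SL(W)` on `𝔫` by graded automorphisms. -/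
def nilAct (s : SpecialLinearGroup ℂ W) (X : d.Nil) : d.Nil :=
  ⟨LinearMap.lTensor V (s : W ≃ₗ[ℂ] W).toLinearMap X.one, X.two, s • X.three⟩

theorem bracketOne_act (s : SpecialLinearGroup ℂ W) (x y : V ⊗[ℂ] W) :
    d.bracketOne (LinearMap.lTensor V (s : W ≃ₗ[ℂ] W).toLinearMap x)
      (LinearMap.lTensor V (s : W ≃ₗ[ℂ] W).toLinearMap y) = d.bracketOne x y := by
  induction x with
  | zero => simp
  | add x x' hx hx' => simp only [map_add, LinearMap.add_apply, hx, hx']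
  | tmul v w =>
    induction y with
    | zero => simp
    | add y y' hy hy' => simp only [map_add, hy, hy']
    | tmul v' w' =>
      have := d.form_map s w w'
      simp only [LinearMap.lTensor_tmul, bracketOne_tmul]
      exact congrArg (· • d.B v v') this

theorem bracketTwo_act (s : SpecialLinearGroup ℂ W) (f : Module.Dual ℂ V) (x : V ⊗[ℂ] W) :
    d.bracketTwo f (LinearMap.lTensor V (s : W ≃ₗ[ℂ] W).toLinearMap x) =
      s • d.bracketTwo f x := by
  induction x with
  | zero => simp
  | add x x' hx hx' => simp only [map_add, smul_add, hx, hx']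
  | tmul v w =>
    simp only [LinearMap.lTensor_tmul, bracketTwo_tmul]
    exact (map_smul (s : W ≃ₗ[ℂ] W) (f v) w).symm

/-- The action of `SL(W)` on `N` by automorphisms. -/
def grpAct (s : SpecialLinearGroup ℂ W) (g : d.N) : d.N := N.exp (d.nilAct s g.log)

theorem grpAct_mul (s : SpecialLinearGroup ℂ W) (g h : d.N) :
    d.grpAct s (g * h) = d.grpAct s g * d.grpAct s h := by
  ext1
  ext1
  · simp only [N.log_mul_one, grpAct, nilAct, map_add]
  · simp only [N.log_mul_two, grpAct, nilAct, bracketOne_act]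
  · have h : ∀ (t : ℂ) (w : W), s • t • w = t • s • w := map_smul (s : W ≃ₗ[ℂ] W)
    simp only [N.log_mul_one, N.log_mul_two, N.log_mul_three, grpAct, nilAct, bracketOne_act,
      bracketTwo_act, smul_add, smul_sub, h]

theorem grpAct_one (g : d.N) : d.grpAct 1 g = g := by
  ext1
  ext1
  · exact LinearMap.congr_fun (LinearMap.lTensor_id V W) g.log.one
  · rfl
  · exact one_smul _ _

theorem grpAct_comp (s t : SpecialLinearGroup ℂ W) (g : d.N) :
    d.grpAct (s * t) g = d.grpAct s (d.grpAct t g) := by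
  ext1
  ext1
  · exact LinearMap.lTensor_comp_apply (M := V) _ _ g.log.one
  · rfl
  · exact mul_smul _ _ _

/-- `SL(W)` acting on `N`, as a homomorphism to the automorphism group. -/
def autHom : SpecialLinearGroup ℂ W →* MulAut d.N where
  toFun s :=
    { toFun := d.grpAct s
      invFun := d.grpAct s⁻¹
      left_inv g := by rw [← grpAct_comp, inv_mul_cancel, grpAct_one]
      right_inv g := by rw [← grpAct_comp, mul_inv_cancel, grpAct_one]
      map_mul' := d.grpAct_mul s }
  map_one' := by
    ext1 g
    exact d.grpAct_one g
  map_mul' s t := by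
    ext1 g
    exact d.grpAct_comp s t g

/-- The group `G = N ⋊ SL(W)`. -/
abbrev G : Type _ := d.N ⋊[d.autHom] SpecialLinearGroup ℂ W

theorem grpAct_mem_A (s : SpecialLinearGroup ℂ W) (ℓ : ℙ ℂ W) {g : d.N} (hg : g ∈ d.A ℓ) :
    d.grpAct s g ∈ d.A (s • ℓ) := by
  obtain ⟨⟨x, hx⟩, h2, h3⟩ := hg
  refine ⟨?_, h2, ?_⟩
  · change LinearMap.lTensor V (s : W ≃ₗ[ℂ] W).toLinearMap g.log.one ∈ _
    rw [← hx]
    clear hx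
    induction x with
    | zero => simp
    | add x x' hx hx' =>
      simp only [map_add]
      exact add_mem hx hx'
    | tmul v w =>
      have hw : s • (w : W) ∈ (s • ℓ).submodule := by
        obtain ⟨w, hw⟩ := w
        induction ℓ with
        | h u hu =>
          rw [Projectivization.smul_mk, Projectivization.submodule_mk]
          rw [Projectivization.submodule_mk] at hw
          obtain ⟨t, rfl⟩ := Submodule.mem_span_singleton.1 hw
          refine Submodule.mem_span_singleton.2 ⟨t, ?_⟩
          exact (map_smul (s : W ≃ₗ[ℂ] W) t u).symm
      exact ⟨v ⊗ₜ ⟨_, hw⟩, rfl⟩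
  · change s • g.log.three = 0
    rw [h3, smul_zero]

/-- `(n, s)` maps the class of `g` in `N / A_ℓ` to the class of `n · s(g)` in `N / A_{sℓ}`. -/
instance : MulAction d.G d.X where
  smul a x := ⟨a.right • x.1, Quotient.map' (fun g => a.left * d.grpAct a.right g) (by
    intro g h hgh
    rw [QuotientGroup.leftRel_apply] at hgh ⊢
    have := d.grpAct_mem_A a.right x.1 hgh
    have e : (a.left * d.grpAct a.right g)⁻¹ * (a.left * d.grpAct a.right h) =
        d.grpAct a.right (g⁻¹ * h) := by
      have := (d.autHom a.right).map_mul g⁻¹ h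
      rw [map_inv] at this
      change _ = (d.autHom a.right) (g⁻¹ * h)
      rw [this]
      change (a.left * d.autHom a.right g)⁻¹ * (a.left * d.autHom a.right h) = _
      group
    rw [e]
    exact this) x.2⟩
  one_smul x := by
    obtain ⟨g, ℓ, rfl⟩ := d.ξ_surj x
    change d.ξ (1 * d.grpAct 1 g) ((1 : SpecialLinearGroup ℂ W) • ℓ) = _
    rw [one_mul, grpAct_one, one_smul]
  mul_smul a b x := by
    obtain ⟨g, ℓ, rfl⟩ := d.ξ_surj x
    change d.ξ ((a.left * d.grpAct a.right b.left) * d.grpAct (a.right * b.right) g)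
      ((a.right * b.right) • ℓ) =
      d.ξ (a.left * d.grpAct a.right (b.left * d.grpAct b.right g)) (a.right • b.right • ℓ)
    rw [mul_smul, grpAct_comp, grpAct_mul, mul_assoc]

theorem smul_ξ (a : d.G) (g : d.N) (ℓ : ℙ ℂ W) :
    a • d.ξ g ℓ = d.ξ (a.left * d.grpAct a.right g) (a.right • ℓ) := rfl

end Algebra

section Manifold

variable {V W : Type*} [NormedAddCommGroup V] [NormedSpace ℂ V] [FiniteDimensional ℂ V]
  [NormedAddCommGroup W] [NormedSpace ℂ W] [Fact (Module.finrank ℂ W = 2)] (d : CubicData V W)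

instance : TopologicalSpace (ℙ ℂ W) := (ProjLine.atlas (W := W) Fact.out).topology
instance : ChartedSpace ℂ (ℙ ℂ W) := (ProjLine.atlas (W := W) Fact.out).chartedSpace
instance : IsManifold 𝓘(ℂ, ℂ) ω (ℙ ℂ W) := (ProjLine.atlas (W := W) Fact.out).isManifold

/-- The space `𝔫_m × ℂ = (V ⊗ m̂) ⊕ V* ⊕ W ⊕ ℂ` of local coordinates on `X_c`, of dimension
`2 dim V + 3`; here `m̂` is identified with `ℂ`. -/
abbrev Model (V W : Type*) [NormedAddCommGroup V] [NormedSpace ℂ V] [NormedAddCommGroup W]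
    [NormedSpace ℂ W] : Type _ := V × StrongDual ℂ V × W × ℂ

/-- The element `v ⊗ m + f + w` of `𝔫_m`, where `m = b₁`. -/
def nilOf (b : Module.Basis (Fin 2) ℂ W) (e : Model V W) : d.Nil :=
  ⟨e.1 ⊗ₜ b 1, e.2.1.toLinearMap, e.2.2.1⟩

/-- For a basis `b = (l, m)` of `W`, the local parametrization
`(Y, z) ↦ ξ (exp Y, [l + z m])` of `X_c`, where `Y ∈ 𝔫_m`. -/
def param (b : Module.Basis (Fin 2) ℂ W) (e : Model V W) : d.X :=
  d.ξ (N.exp (d.nilOf b e)) (ProjLine.param b e.2.2.2)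

theorem exists_tmul (b : Module.Basis (Fin 2) ℂ W) (z : ℂ) {x : V ⊗[ℂ] W}
    (hx : x ∈ LinearMap.range (LinearMap.lTensor V (ProjLine.param b z).submodule.subtype)) :
    ∃ u : V, x = u ⊗ₜ (b 0 + z • b 1) := by
  obtain ⟨x, rfl⟩ := hx
  induction x with
  | zero => exact ⟨0, by simp⟩
  | add x y hx hy =>
    obtain ⟨u, hu⟩ := hx
    obtain ⟨v, hv⟩ := hy
    exact ⟨u + v, by rw [map_add, hu, hv, TensorProduct.add_tmul]⟩
  | tmul v w =>
    obtain ⟨w, hw⟩ := w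
    rw [ProjLine.param, Projectivization.submodule_mk, Submodule.mem_span_singleton] at hw
    obtain ⟨t, rfl⟩ := hw
    exact ⟨t • v, by simp [TensorProduct.smul_tmul]⟩

theorem tmul_mem (b : Module.Basis (Fin 2) ℂ W) (z : ℂ) (u : V) :
    u ⊗ₜ (b 0 + z • b 1) ∈
      LinearMap.range (LinearMap.lTensor V (ProjLine.param b z).submodule.subtype) := by
  have : b 0 + z • b 1 ∈ (ProjLine.param b z).submodule := by
    rw [ProjLine.param, Projectivization.submodule_mk]
    exact Submodule.mem_span_singleton_self _
  exact ⟨u ⊗ₜ ⟨_, this⟩, rfl⟩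

/-- The coefficient of `bᵢ` in an element of `V ⊗ W`. -/
def coeff (b : Module.Basis (Fin 2) ℂ W) (i : Fin 2) : V ⊗[ℂ] W →ₗ[ℂ] V :=
  (TensorProduct.rid ℂ V).toLinearMap ∘ₗ LinearMap.lTensor V (b.coord i)

theorem coeff_tmul (b : Module.Basis (Fin 2) ℂ W) (i : Fin 2) (v : V) (w : W) :
    coeff b i (v ⊗ₜ w) = b.repr w i • v := by
  simp [coeff]

theorem param_injective (b : Module.Basis (Fin 2) ℂ W) : Function.Injective (d.param b) := by
  intro e e' h
  obtain ⟨hz, hA⟩ := (d.ξ_eq_iff _ _ _ _).1 h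
  obtain ⟨a, ha⟩ : ∃ a, a = (N.exp (d.nilOf b e))⁻¹ * N.exp (d.nilOf b e') := ⟨_, rfl⟩
  rw [← ha] at hA
  have hm : N.exp (d.nilOf b e') = N.exp (d.nilOf b e) * a := by
    rw [ha]
    group
  obtain ⟨h1, h2, h3⟩ := hA
  obtain ⟨u, hu⟩ := exists_tmul b _ h1
  have hone := congrArg (fun g : d.N => coeff b 0 g.log.one) hm
  simp only [N.log_mul_one, nilOf, hu, map_add, coeff_tmul] at hone
  have hu0 : u = 0 := by simpa using hone.symm
  have ha1 : a = 1 := by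
    ext1
    ext1
    · rw [hu, hu0, TensorProduct.zero_tmul]
      rfl
    · exact h2
    · exact h3
  rw [ha1, mul_one] at hm
  have hn : d.nilOf b e' = d.nilOf b e := congrArg N.log hm
  have hv := congrArg (fun g : d.Nil => coeff b 1 g.one) hn
  simp only [nilOf, coeff_tmul] at hv
  refine Prod.ext ?_ (Prod.ext ?_ (Prod.ext ?_ ?_))
  · simpa using hv.symm
  · exact ContinuousLinearMap.coe_injective (congrArg Nil.two hn).symm
  · exact (congrArg Nil.three hn).symm
  · exact ProjLine.param_injective b hz

/-- `B` as a continuous bilinear map. -/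
def Bcont : V →L[ℂ] V →L[ℂ] StrongDual ℂ V :=
  LinearMap.toContinuousBilinearMap
    (d.c.compr₂ (LinearMap.toContinuousLinearMap (𝕜 := ℂ) (E := V) (F' := ℂ)).toLinearMap)

theorem Bcont_apply (u v w : V) : d.Bcont u v w = d.c u v w := rfl

/-- The change of coordinates between the parametrizations of two bases. -/
def change (b b' : Module.Basis (Fin 2) ℂ W) (e : Model V W) : Model V W :=
  let k : ℂ := b'.repr (b 1) 0
  let z : ℂ := ProjLine.change b b' e.2.2.2
  let a : ℂ := d.form (b 1) (b' 0) + z * d.form (b 1) (b' 1)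
  ((b'.repr (b 1) 1 - k * z) • e.1,
    e.2.1 - (2⁻¹ * k * a) • d.Bcont e.1 e.1,
    e.2.2.1 - (2⁻¹ * k * e.2.1 e.1) • (b' 0 + z • b' 1)
      + (12⁻¹ * k * a * d.Bcont e.1 e.1 e.1) • b 1
      + (12⁻¹ * k ^ 2 * a * d.Bcont e.1 e.1 e.1) • (b' 0 + z • b' 1),
    z)

theorem param_change (b b' : Module.Basis (Fin 2) ℂ W) (e : Model V W)
    (h : b'.repr (b 0) 0 + e.2.2.2 * b'.repr (b 1) 0 ≠ 0) :
    d.param b' (d.change b b' e) = d.param b e := by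
  obtain ⟨a, ha⟩ : ∃ a : d.N, a = N.exp ⟨(-(b'.repr (b 1) 0) • e.1) ⊗ₜ
    (b' 0 + ProjLine.change b b' e.2.2.2 • b' 1), 0, 0⟩ := ⟨_, rfl⟩
  have hb : b 1 = b'.repr (b 1) 0 • b' 0 + b'.repr (b 1) 1 • b' 1 := by
    rw [← Fin.sum_univ_two (fun i => b'.repr (b 1) i • b' i), b'.sum_repr]
  have hm : N.exp (d.nilOf b' (d.change b b' e)) = N.exp (d.nilOf b e) * a := by
    ext1
    ext1
    · rw [N.log_mul_one, ha]
      have hx : e.1 ⊗ₜ[ℂ] b 1 = b'.repr (b 1) 0 • (e.1 ⊗ₜ[ℂ] b' 0) +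
          b'.repr (b 1) 1 • (e.1 ⊗ₜ[ℂ] b' 1) := by
        conv_lhs => rw [hb]
        simp only [TensorProduct.tmul_add, TensorProduct.tmul_smul]
      simp only [nilOf, change, hx, TensorProduct.tmul_add, TensorProduct.tmul_smul,
        ← TensorProduct.smul_tmul']
      module
    · rw [N.log_mul_two, ha]
      simp only [nilOf, change, bracketOne_tmul]
      ext v
      simp [Bcont_apply]
      ring
    · rw [N.log_mul_three, ha]
      simp only [nilOf, change, bracketOne_tmul, bracketTwo_tmul]
      simp [Bcont_apply, -smul_add]
      module
  refine (d.ξ_eq_iff _ _ _ _).2 ⟨ProjLine.param_change b b' _ h, ?_⟩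
  rw [hm, mul_inv_rev, mul_assoc, inv_mul_cancel, mul_one]
  refine inv_mem ?_
  rw [ha]
  exact ⟨tmul_mem b' _ _, rfl, rfl⟩

theorem param_mem_range_iff (b b' : Module.Basis (Fin 2) ℂ W) (e : Model V W) :
    d.param b e ∈ Set.range (d.param b') ↔
      b'.repr (b 0) 0 + e.2.2.2 * b'.repr (b 1) 0 ≠ 0 := by
  constructor
  · rintro ⟨e', he⟩
    exact (ProjLine.param_mem_range_iff b b' _).1 ⟨_, congrArg Sigma.fst he⟩
  · intro h
    exact ⟨_, d.param_change b b' e h⟩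

theorem exists_param (b : Module.Basis (Fin 2) ℂ W) (x : d.X)
    (hx : x.1 ∈ Set.range (ProjLine.param b)) : x ∈ Set.range (d.param b) := by
  obtain ⟨g, ℓ, rfl⟩ := d.ξ_surj x
  obtain ⟨z, rfl⟩ := hx
  obtain ⟨a, ha⟩ : ∃ a : d.N, a = N.exp ⟨(-coeff b 0 g.log.one) ⊗ₜ (b 0 + z • b 1), 0, 0⟩ :=
    ⟨_, rfl⟩
  have haA : a ∈ d.A (ProjLine.param b z) := by
    rw [ha]
    exact ⟨tmul_mem b _ _, rfl, rfl⟩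
  have hg : ∀ y : V ⊗[ℂ] W, y = coeff b 0 y ⊗ₜ b 0 + coeff b 1 y ⊗ₜ b 1 := by
    intro y
    induction y with
    | zero => simp
    | add y y' hy hy' =>
      conv_lhs => rw [hy, hy']
      simp only [map_add, TensorProduct.add_tmul]
      abel
    | tmul v w =>
      have hw : w = b.repr w 0 • b 0 + b.repr w 1 • b 1 := by
        rw [← Fin.sum_univ_two (fun i => b.repr w i • b i), b.sum_repr]
      conv_lhs => rw [hw]
      simp only [coeff_tmul, TensorProduct.tmul_add, TensorProduct.smul_tmul]
  refine ⟨((coeff b 1 g.log.one - z • coeff b 0 g.log.one),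
    LinearMap.toContinuousLinearMap (g * a).log.two, (g * a).log.three, z), ?_⟩
  refine (d.ξ_eq_iff _ _ _ _).2 ⟨rfl, ?_⟩
  have : N.exp (d.nilOf b ((coeff b 1 g.log.one - z • coeff b 0 g.log.one),
    LinearMap.toContinuousLinearMap (g * a).log.two, (g * a).log.three, z)) = g * a := by
    ext1
    ext1
    · rw [N.log_mul_one]
      conv_rhs => rw [hg g.log.one, ha]
      simp only [nilOf, TensorProduct.tmul_add, TensorProduct.neg_tmul, TensorProduct.sub_tmul,
        TensorProduct.smul_tmul]
      abel
    · rfl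
    · rfl
  rw [this, mul_inv_rev, mul_assoc, inv_mul_cancel, mul_one]
  exact inv_mem haA

theorem contDiffOn_change (b b' : Module.Basis (Fin 2) ℂ W) :
    ContDiffOn ℂ ω (d.change b b')
      {e : Model V W | b'.repr (b 0) 0 + e.2.2.2 * b'.repr (b 1) 0 ≠ 0} := by
  have hz : ContDiffOn ℂ ω (fun e : Model V W => ProjLine.change b b' e.2.2.2)
      {e : Model V W | b'.repr (b 0) 0 + e.2.2.2 * b'.repr (b 1) 0 ≠ 0} :=
    (ProjLine.contDiffOn_change b b').comp (f := fun e : Model V W => e.2.2.2)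
      (by fun_prop) (fun e he => he)
  unfold change
  fun_prop

/-- The atlas of `X_c` given by the local parametrizations `(Y, z) ↦ ξ (exp Y, [l + z m])`, for all
bases `(l, m)` of `W`. Since `𝔫_m` is a complement of `𝔞_p` in `𝔫` for every `p ≠ [m]`, they
parametrize the parts of `X_c` over the affine lines `ℙ W - [m]`, and they are the local charts
of the family of quotients `N / A_p`. -/
def atlas : HolAtlas (Module.Basis (Fin 2) ℂ W) (Model V W) d.X where
  param := d.param
  param_injective := d.param_injective
  idx x := (ProjLine.exists_basis Fact.out x.1).choose
  mem_range x := d.exists_param _ x (ProjLine.exists_basis Fact.out x.1).choose_spec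
  isOpen_overlap b b' := by
    have : d.param b ⁻¹' Set.range (d.param b') =
        {e | b'.repr (b 0) 0 + e.2.2.2 * b'.repr (b 1) 0 ≠ 0} := by
      ext e
      exact d.param_mem_range_iff b b' e
    rw [this]
    exact isOpen_ne_fun (by fun_prop) continuous_const
  contDiffOn_change b b' := by
    have : d.param b ⁻¹' Set.range (d.param b') =
        {e | b'.repr (b 0) 0 + e.2.2.2 * b'.repr (b 1) 0 ≠ 0} := by
      ext e
      exact d.param_mem_range_iff b b' e
    rw [this]
    refine (d.contDiffOn_change b b').congr fun e he => ?_
    rw [← d.param_change b b' e he]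
    exact Function.leftInverse_invFun (d.param_injective b') _

instance : TopologicalSpace d.X := d.atlas.topology
instance : ChartedSpace (Model V W) d.X := d.atlas.chartedSpace
instance : IsManifold 𝓘(ℂ, Model V W) ω d.X := d.atlas.isManifold

/-- The underlying map of the projection `ψ : X_c → ℙ W`. -/
def proj (x : d.X) : ℙ ℂ W := x.1

theorem contMDiff_proj : ContMDiff 𝓘(ℂ, Model V W) 𝓘(ℂ, ℂ) ω d.proj := by
  intro x
  have hx := d.atlas.mem_range x
  have ho := d.atlas.isOpen_range (d.atlas.idx x)
  have h1 := d.atlas.contMDiffOn_chart (d.atlas.idx x)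
  have h2 := (ProjLine.atlas (W := W) Fact.out).contMDiff_param (d.atlas.idx x)
  have h3 : ContMDiff 𝓘(ℂ, Model V W) 𝓘(ℂ, ℂ) ω (fun e : Model V W => e.2.2.2) :=
    ContDiff.contMDiff (by fun_prop)
  have h4 := (h2.comp h3).comp_contMDiffOn h1
  refine (h4.congr ?_).contMDiffAt (ho.mem_nhds hx)
  rintro _ ⟨e, rfl⟩
  change _ = ProjLine.param _
    (Function.invFun (d.atlas.param (d.atlas.idx x)) (d.atlas.param (d.atlas.idx x) e)).2.2.2
  rw [Function.leftInverse_invFun (d.atlas.param_injective _) e]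
  rfl

/-- The projection `ψ : X_c → ℙ W`, as a holomorphic map. -/
def ψ : C^ω⟮𝓘(ℂ, Model V W), d.X; 𝓘(ℂ, ℂ), ℙ ℂ W⟯ := ⟨d.proj, d.contMDiff_proj⟩

/-! #### The line bundle `L = ψ^* 𝒪(1)` -/

/-- The fibre of `𝒪(1)` at `ℓ`: the dual of the line `ℓ̂`. -/
abbrev O1 (ℓ : ℙ ℂ W) : Type _ := StrongDual ℂ ℓ.submodule

theorem mem_range_iff (b : Module.Basis (Fin 2) ℂ W) (ℓ : ℙ ℂ W) :
    ℓ ∈ Set.range (ProjLine.param b) ↔ b.repr ℓ.rep 0 ≠ 0 := by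
  conv_lhs => rw [← ℓ.mk_rep]
  exact ProjLine.mk_mem_range_iff b _ _

/-- The local section `[b₀ + z b₁] ↦ b₀ + z b₁` of the tautological line bundle. -/
def gen (b : Module.Basis (Fin 2) ℂ W) (ℓ : ℙ ℂ W) : ℓ.submodule :=
  (b.repr ℓ.rep 0)⁻¹ • ⟨ℓ.rep, by
    rw [ℓ.submodule_eq]
    exact Submodule.mem_span_singleton_self _⟩

theorem gen_param (b : Module.Basis (Fin 2) ℂ W) (z : ℂ) :
    (gen b (ProjLine.param b z) : W) = b 0 + z • b 1 := by
  have h : (ProjLine.param b z).rep ∈ (ProjLine.param b z).submodule := by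
    rw [(ProjLine.param b z).submodule_eq]
    exact Submodule.mem_span_singleton_self _
  have h0 := (mem_range_iff b _).1 ⟨z, rfl⟩
  simp only [gen, Submodule.coe_smul]
  rw [ProjLine.param, Projectivization.submodule_mk, Submodule.mem_span_singleton] at h
  change ∃ a : ℂ, _ = (ProjLine.param b z).rep at h
  obtain ⟨t, ht⟩ := h
  rw [← ht] at h0 ⊢
  simp only [map_smul, map_add, Finsupp.smul_apply, Finsupp.add_apply, Module.Basis.repr_self,
    Finsupp.single_eq_same, smul_eq_mul] at h0 ⊢
  have e : (Finsupp.single (1 : Fin 2) (1 : ℂ)) 0 = 0 := by simp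
  rw [e] at h0 ⊢
  rw [smul_smul, mul_zero, add_zero, mul_one] at *
  rw [inv_mul_cancel₀ h0, one_smul]

/-- The coordinate functional `b₀^*` on `ℓ̂`. -/
def cofun (b : Module.Basis (Fin 2) ℂ W) (ℓ : ℙ ℂ W) : O1 ℓ :=
  LinearMap.toContinuousLinearMap ((b.coord 0).domRestrict ℓ.submodule)

theorem cofun_gen (b b' : Module.Basis (Fin 2) ℂ W) (ℓ : ℙ ℂ W) :
    cofun b ℓ (gen b' ℓ) = b.repr (gen b' ℓ) 0 := rfl

theorem cofun_gen_self (b : Module.Basis (Fin 2) ℂ W) (ℓ : ℙ ℂ W)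
    (h : ℓ ∈ Set.range (ProjLine.param b)) : cofun b ℓ (gen b ℓ) = 1 := by
  have h0 := (mem_range_iff b _).1 h
  rw [cofun_gen]
  simp [gen, h0]

theorem eq_smul_gen (b : Module.Basis (Fin 2) ℂ W) (ℓ : ℙ ℂ W)
    (h : ℓ ∈ Set.range (ProjLine.param b)) (w : ℓ.submodule) : w = cofun b ℓ w • gen b ℓ := by
  have h0 := (mem_range_iff b _).1 h
  obtain ⟨w, hw⟩ := w
  have hw' := hw
  rw [ℓ.submodule_eq, Submodule.mem_span_singleton] at hw'
  obtain ⟨t, rfl⟩ := hw'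
  apply Subtype.ext
  have : cofun b ℓ ⟨t • ℓ.rep, hw⟩ = t * b.repr ℓ.rep 0 := by
    change b.repr (t • ℓ.rep) 0 = _
    simp
  rw [this]
  simp only [gen, Submodule.coe_smul, smul_smul]
  congr 1
  field_simp

/-- The local trivialization `λ ↦ λ(b₀ + z b₁)` of `𝒪(1)` over the complement of `[b₁]`. -/
def triv (b : Module.Basis (Fin 2) ℂ W) :
    Bundle.Pretrivialization ℂ (Bundle.TotalSpace.proj : Bundle.TotalSpace ℂ (O1 (W := W)) → _) where
  toFun x := (x.1, x.2 (gen b x.1))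
  invFun y := ⟨y.1, y.2 • cofun b y.1⟩
  source := Bundle.TotalSpace.proj ⁻¹' Set.range (ProjLine.param b)
  target := Set.range (ProjLine.param b) ×ˢ Set.univ
  map_source' x hx := ⟨hx, Set.mem_univ _⟩
  map_target' y hy := hy.1
  left_inv' x hx := by
    obtain ⟨ℓ, l⟩ := x
    refine congrArg (Bundle.TotalSpace.mk ℓ) ?_
    ext w
    conv_rhs => rw [eq_smul_gen b ℓ hx w, map_smul]
    simp [mul_comm]
  right_inv' y hy := by
    refine Prod.ext rfl ?_
    have := cofun_gen_self b y.1 hy.1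
    simp [this]
  open_target := ((ProjLine.atlas (W := W) Fact.out).isOpen_range b).prod isOpen_univ
  baseSet := Set.range (ProjLine.param b)
  open_baseSet := (ProjLine.atlas (W := W) Fact.out).isOpen_range b
  source_eq := rfl
  target_eq := rfl
  proj_toFun _ _ := rfl

theorem triv_symm (b : Module.Basis (Fin 2) ℂ W) (ℓ : ℙ ℂ W)
    (h : ℓ ∈ Set.range (ProjLine.param b)) (y : ℂ) : (triv b).symm ℓ y = y • cofun b ℓ := by
  rw [Bundle.Pretrivialization.symm_apply (triv b) h]
  rfl

theorem contMDiffOn_gen (b b' : Module.Basis (Fin 2) ℂ W) :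
    ContMDiffOn 𝓘(ℂ, ℂ) 𝓘(ℂ, ℂ) ω (fun ℓ : ℙ ℂ W => cofun b ℓ (gen b' ℓ))
      (Set.range (ProjLine.param b')) := by
  have h1 := (ProjLine.atlas (W := W) Fact.out).contMDiffOn_chart b'
  have h2 : ContMDiff 𝓘(ℂ, ℂ) 𝓘(ℂ, ℂ) ω
      (fun z : ℂ => b.repr (b' 0) 0 + z * b.repr (b' 1) 0) :=
    ContDiff.contMDiff (by fun_prop)
  refine (h2.comp_contMDiffOn h1).congr ?_
  rintro _ ⟨z, rfl⟩
  change b.repr (gen b' (ProjLine.param b' z)) 0 = b.repr (b' 0) 0 +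
    Function.invFun (ProjLine.param b') (ProjLine.param b' z) * b.repr (b' 1) 0
  rw [gen_param]
  have := Function.leftInverse_invFun (ProjLine.param_injective b') z
  rw [this]
  simp

theorem contMDiffOn_coordChange (b b' : Module.Basis (Fin 2) ℂ W) :
    ContMDiffOn 𝓘(ℂ, ℂ) 𝓘(ℂ, ℂ →L[ℂ] ℂ) ω
      (fun ℓ : ℙ ℂ W => cofun b ℓ (gen b' ℓ) • ContinuousLinearMap.id ℂ ℂ)
      (Set.range (ProjLine.param b) ∩ Set.range (ProjLine.param b')) := by
  have h2 : ContMDiff 𝓘(ℂ, ℂ) 𝓘(ℂ, ℂ →L[ℂ] ℂ) ω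
      (fun z : ℂ => z • ContinuousLinearMap.id ℂ ℂ) :=
    ContDiff.contMDiff (by fun_prop)
  exact (h2.comp_contMDiffOn (contMDiffOn_gen b b')).mono Set.inter_subset_right

/-- The bundle structure of `𝒪(1)`. -/
def prebundle : VectorPrebundle ℂ ℂ (O1 (W := W)) where
  pretrivializationAtlas := Set.range triv
  pretrivialization_linear' := by
    rintro _ ⟨b, rfl⟩
    exact ⟨fun ℓ _ => ⟨fun _ _ => rfl, fun _ _ => rfl⟩⟩
  pretrivializationAt ℓ := triv (ProjLine.exists_basis Fact.out ℓ).choose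
  mem_base_pretrivializationAt ℓ := (ProjLine.exists_basis Fact.out ℓ).choose_spec
  pretrivialization_mem_atlas ℓ := ⟨_, rfl⟩
  exists_coordChange := by
    rintro _ ⟨b, rfl⟩ _ ⟨b', rfl⟩
    refine ⟨_, (contMDiffOn_coordChange b b').continuousOn, fun ℓ hℓ y => ?_⟩
    rw [triv_symm b ℓ hℓ.1]
    change cofun b ℓ (gen b' ℓ) • y = y • cofun b ℓ (gen b' ℓ)
    simp [mul_comm]
  totalSpaceMk_isInducing ℓ := by
    obtain ⟨b, hb⟩ : ∃ b, b = (ProjLine.exists_basis Fact.out ℓ).choose := ⟨_, rfl⟩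
    rw [← hb]
    have h : ℓ ∈ Set.range (ProjLine.param b) := by
      rw [hb]
      exact (ProjLine.exists_basis Fact.out ℓ).choose_spec
    have hc : Continuous fun l : O1 ℓ => (ℓ, l (gen b ℓ)) := by fun_prop
    refine (Topology.IsEmbedding.of_leftInverse (g := fun l : O1 ℓ => (ℓ, l (gen b ℓ)))
      (f := fun y : ℙ ℂ W × ℂ => y.2 • cofun b ℓ) ?_ (by fun_prop) hc).isInducing
    intro l
    ext w
    conv_rhs => rw [eq_smul_gen b ℓ h w, map_smul]
    simp [mul_comm]

instance : (prebundle (W := W)).IsContMDiff 𝓘(ℂ, ℂ) ω where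
  exists_contMDiffCoordChange := by
    rintro _ ⟨b, rfl⟩ _ ⟨b', rfl⟩
    refine ⟨_, contMDiffOn_coordChange b b', fun ℓ hℓ y => ?_⟩
    rw [triv_symm b ℓ hℓ.1]
    change cofun b ℓ (gen b' ℓ) • y = y • cofun b ℓ (gen b' ℓ)
    simp [mul_comm]

instance : TopologicalSpace (Bundle.TotalSpace ℂ (O1 (W := W))) := prebundle.totalSpaceTopology
instance : FiberBundle ℂ (O1 (W := W)) := prebundle.toFiberBundle
instance : VectorBundle ℂ ℂ (O1 (W := W)) := prebundle.toVectorBundle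
instance : ContMDiffVectorBundle ω ℂ (O1 (W := W)) 𝓘(ℂ, ℂ) :=
  prebundle.contMDiffVectorBundle 𝓘(ℂ, ℂ)

/-- The line bundle `L = ψ^* 𝒪(1)` on `X_c`. -/
abbrev L : d.X → Type _ := (d.ψ : d.X → ℙ ℂ W) *ᵖ (O1 (W := W))

/-! #### The invariant distribution -/

/-- The base point `x_ℓ = ξ(o, ℓ)`. -/
def basePoint (ℓ : ℙ ℂ W) : d.X := d.ξ 1 ℓ

/-- The velocity at `t = 0` of the curve `t ↦ ξ (exp (tY), ℓ)`, that is, the image of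
`Y ∈ 𝔫 = T_o N` under the differential of `ξ` at `(o, ℓ)`. -/
def velocity (ℓ : ℙ ℂ W) (Y : d.Nil) : TangentSpace 𝓘(ℂ, Model V W) (d.basePoint ℓ) :=
  mfderiv 𝓘(ℂ, ℂ) 𝓘(ℂ, Model V W) (fun t : ℂ => d.ξ (N.exp (t • Y)) ℓ) 0 (1 : ℂ)

/-- The subspace `D_{x_ℓ} = 𝔫₁/𝔞_ℓ ⊕ 𝔫₂ ⊕ ℓ̂ ⊕ T_ℓ(ℙ W)` of the tangent space of `X_c` at `x_ℓ`:
the image under the differential of `ξ` at `(o, ℓ)` of the vectors `(Y, τ) ∈ 𝔫 ⊕ T_ℓ(ℙ W)` such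
that the `𝔫₃`-component of `Y` lies in `ℓ̂`. -/
def baseHyperplane (ℓ : ℙ ℂ W) :
    Submodule ℂ (TangentSpace 𝓘(ℂ, Model V W) (d.basePoint ℓ)) :=
  Submodule.span ℂ (d.velocity ℓ '' {Y : d.Nil | Y.three ∈ ℓ.submodule}) ⊔
    LinearMap.range (mfderiv 𝓘(ℂ, ℂ) 𝓘(ℂ, Model V W) (fun m : ℙ ℂ W => d.ξ 1 m) ℓ).toLinearMap

/-- Invariance of a distribution on `X_c` under the action of `G`, which is by holomorphic maps. -/
def IsInvariant (D : TangentDistribution (Model V W) d.X) : Prop :=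
  ∀ (g : d.G) (x : d.X),
    MDifferentiableAt 𝓘(ℂ, Model V W) 𝓘(ℂ, Model V W) (fun y : d.X => g • y) x ∧
    D (g • x) = (D x).map
      (mfderiv 𝓘(ℂ, Model V W) 𝓘(ℂ, Model V W) (fun y : d.X => g • y) x).toLinearMap

/-- `T(X_c)/D ≅ L` as holomorphic line bundles: there is a holomorphic morphism of vector bundles
`T(X_c) → L` that is surjective on the fibres, with kernel `D`. -/
def QuotientIsoL (D : TangentDistribution (Model V W) d.X) : Prop :=
  ∃ θ : ∀ x : d.X, TangentSpace 𝓘(ℂ, Model V W) x →L[ℂ] d.L x,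
    ContMDiff 𝓘(ℂ, Model V W).tangent (𝓘(ℂ, Model V W).prod 𝓘(ℂ, ℂ)) ω
      (fun v : TangentBundle 𝓘(ℂ, Model V W) d.X =>
        (⟨v.proj, θ v.proj v.2⟩ : Bundle.TotalSpace ℂ d.L)) ∧
    ∀ x, Function.Surjective (θ x) ∧ LinearMap.ker (θ x).toLinearMap = D x

end Manifold

end CubicData

end

/-!
The contact structure on `X_c` comes from an `L`-valued 1-form `theta`. Along a curve
`ξ (g, ℓ)` with `g = exp X` in `N` and `ℓ` in `ℙ W`, let `η` be the `𝔫₃`-component of the left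
logarithmic derivative `g⁻¹ dg` (`maurerCartan`). Then `theta` sends the velocity of the curve to the
functional `ω(η, ·)` on `ℓ̂`, an element of the fibre of `L = ψ^* 𝒪(1)` (`theta_curve`).

This is well defined because the representative `g` may only be changed to `g a` with a curve `a` in
the groups `A_ℓ`. By the product rule `maurerCartan_bch`, such a change, even
if `ℓ` varies, modifies `η` by elements of `ℓ̂`, since `[𝔫₂, V ⊗ ℓ̂] ⊂ ℓ̂`; and `ω` vanishes on `ℓ̂`
(`form_maurerCartan_bch`). The description is visibly invariant
under left translations and equivariant under `SL(W)`, so the kernel `D` of `theta` is a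
`G`-invariant distribution (`theta_smul`). It is the only one with the given value at `x_ℓ`, since `G`
acts transitively on `X_c`. At `x_ℓ` one has `g⁻¹ dg = dX`, and `ω(Y₃, ·)` vanishes on `ℓ̂` exactly if
`Y₃ ∈ ℓ̂`, which gives the prescribed hyperplane (`contactDistribution_basePoint`).

In the coordinates `(v, f, w, z) ↦ ξ (exp (v ⊗ m + f + w), [l + z m])` given by a basis `(l, m)` of
`W`, the value of `theta` on `l + z m` is the polynomial 1-form
`α = ω(dw, l + z m) - ½ (f(dv) - df(v)) ω(m, l)` (`contactForm`). Hence `theta` is holomorphic, and it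
is surjective onto the fibres of `L`, so that `T(X_c)/D ≅ L`. The exterior derivative of `α` pairs
`df` with `dv` and `dz` with `ω(dw, m)`, which together with `ω(dw, l + z m)` are coordinates of the
tangent space, so `dα` is non-degenerate on the kernel of `α` (`eq_zero_of_contactFormLin`). Passing to
the chart of another basis multiplies `α` by a transition function of `𝒪(1)`, which does not affect
non-degeneracy on the kernel (`localForm_inChart`, `fderiv_smul_affineForm`).
-/

set_option linter.unusedSectionVars false

noncomputable section

/-! ### Coordinates on the projective line -/

namespace ProjLine

variable {W : Type*} [NormedAddCommGroup W] [NormedSpace ℂ W]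

theorem smul_param (s : SpecialLinearGroup ℂ W) (b : Module.Basis (Fin 2) ℂ W) (z : ℂ) :
    s • param b z = param (b.map (s : W ≃ₗ[ℂ] W)) z := by
  unfold param
  rw [Projectivization.smul_mk]
  congr 1
  change (s : W ≃ₗ[ℂ] W) (b 0 + z • b 1) = _
  simp

variable [Fact (Module.finrank ℂ W = 2)]

theorem isOpen_range_param (b : Module.Basis (Fin 2) ℂ W) : IsOpen (Set.range (param b)) :=
  (atlas (W := W) Fact.out).isOpen_range b

theorem contMDiff_param (b : Module.Basis (Fin 2) ℂ W) :
    ContMDiff 𝓘(ℂ, ℂ) 𝓘(ℂ, ℂ) ω (param b) :=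
  (atlas (W := W) Fact.out).contMDiff_param b

theorem contMDiffOn_invFun_param (b : Module.Basis (Fin 2) ℂ W) :
    ContMDiffOn 𝓘(ℂ, ℂ) 𝓘(ℂ, ℂ) ω (Function.invFun (param b)) (Set.range (param b)) :=
  (atlas (W := W) Fact.out).contMDiffOn_chart b

end ProjLine

/-! ### Lines and affine 1-forms in a vector space -/

section VectorSpace

variable {E : Type*} [NormedAddCommGroup E] [NormedSpace ℂ E]

theorem hasDerivAt_line (e e' : E) :
    HasDerivAt (fun t : ℂ => e + t • e') e' 0 :=
  (((hasDerivAt_id (0 : ℂ)).smul_const e').const_add e).congr_deriv (by simp)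

theorem line_zero (e e' : E) :
    e + (0 : ℂ) • e' = e := by
  rw [zero_smul, add_zero]

/-- There is a curve through `e` with velocity `e'`. The value at `0` is given by an equation, so
that a point of a manifold may be replaced by a value of a curve. -/
theorem exists_curve (e e' : E) :
    ∃ c : ℂ → E, c 0 = e ∧ HasDerivAt c e' 0 :=
  ⟨fun t => e + t • e', line_zero e e', hasDerivAt_line e e'⟩

variable [FiniteDimensional ℂ E]

theorem surjective_of_injective (f : E →L[ℂ] E) (hf : Function.Injective f) :
    Function.Surjective f :=
  (LinearMap.injective_iff_surjective (f := f.toLinearMap)).1 hf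

/-- The 1-form on a vector space whose value at `e` is `c + f e`, depending affinely on `e`. It is
defined for an abstract space `E` because instance search for spaces of linear maps on the product
`Model V W` is slow. -/
def affineForm (c : E →ₗ[ℂ] ℂ) (f : E →ₗ[ℂ] E →ₗ[ℂ] ℂ) (e : E) : E →L[ℂ] ℂ :=
  LinearMap.toContinuousLinearMap (c + f e)

theorem hasFDerivAt_affineForm (c : E →ₗ[ℂ] ℂ) (f : E →ₗ[ℂ] E →ₗ[ℂ] ℂ) (e : E) :
    HasFDerivAt (affineForm c f) (LinearMap.toContinuousBilinearMap f) e :=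
  ((LinearMap.toContinuousBilinearMap f).hasFDerivAt (x := e)).const_add
    (LinearMap.toContinuousLinearMap c)

theorem contDiff_affineForm_apply (c : E →ₗ[ℂ] ℂ) (f : E →ₗ[ℂ] E →ₗ[ℂ] ℂ) :
    ContDiff ℂ ω fun p : E × E => affineForm c f p.1 p.2 :=
  ((LinearMap.toContinuousLinearMap c).contDiff.comp contDiff_snd).add
    ((LinearMap.toContinuousBilinearMap f).isBoundedBilinearMap.contDiff)

/-- On the kernel of a 1-form `α` the exterior derivative of `h α` is `h dα`. -/
theorem fderiv_smul_affineForm (c : E →ₗ[ℂ] ℂ) (f : E →ₗ[ℂ] E →ₗ[ℂ] ℂ) {h : E → ℂ} {p : E}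
    (hh : DifferentiableAt ℂ h p) {u v : E} (hu : affineForm c f p u = 0)
    (hv : affineForm c f p v = 0) :
    fderiv ℂ (fun p => h p • affineForm c f p) p u v -
      fderiv ℂ (fun p => h p • affineForm c f p) p v u = h p * (f u v - f v u) := by
  have h1 := hh.hasFDerivAt.smul (hasFDerivAt_affineForm c f p)
  have h2 : fderiv ℂ (fun p => h p • affineForm c f p) p = _ := h1.fderiv
  rw [h2]
  have h3 (u v : E) : LinearMap.toContinuousBilinearMap f u v = f u v := rfl
  simp [hu, hv, h3]
  ring

end VectorSpace

/-! ### The Maurer–Cartan form of `N` in exponential coordinates -/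

namespace CubicData

section MaurerCartan

variable {V W : Type*} [AddCommGroup V] [Module ℂ V] [AddCommGroup W] [Module ℂ W]
  [Fact (Module.finrank ℂ W = 2)] (d : CubicData V W)

/-- The derivative of the Baker–Campbell–Hausdorff product at `(X, Y)` in the direction
`(X', Y')`. -/
def bchDeriv (X Y X' Y' : d.Nil) : d.Nil :=
  X' + Y' + (1 / 2 : ℂ) • (⁅X', Y⁆ + ⁅X, Y'⁆) +
    (1 / 12 : ℂ) • (⁅X', ⁅X, Y⁆⁆ + ⁅X, ⁅X', Y⁆ + ⁅X, Y'⁆⁆) +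
    (1 / 12 : ℂ) • (⁅Y', ⁅Y, X⁆⁆ + ⁅Y, ⁅Y', X⁆ + ⁅Y, X'⁆⁆)

theorem bchDeriv_one (X Y X' Y' : d.Nil) : (d.bchDeriv X Y X' Y').one = X'.one + Y'.one := by
  simp [bchDeriv, -lie_lie]

theorem bchDeriv_two (X Y X' Y' : d.Nil) : (d.bchDeriv X Y X' Y').two =
    X'.two + Y'.two + (1 / 2 : ℂ) • (d.bracketOne X'.one Y.one + d.bracketOne X.one Y'.one) := by
  simp [bchDeriv, -lie_lie]

theorem bchDeriv_three (X Y X' Y' : d.Nil) : (d.bchDeriv X Y X' Y').three =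
    X'.three + Y'.three +
    (1 / 2 : ℂ) • (d.bracketTwo X'.two Y.one + d.bracketTwo X.two Y'.one
      - d.bracketTwo Y'.two X.one - d.bracketTwo Y.two X'.one)
    - (1 / 12 : ℂ) • (d.bracketTwo (d.bracketOne X'.one Y.one) X.one +
      d.bracketTwo (d.bracketOne X.one Y'.one) X.one +
      d.bracketTwo (d.bracketOne X.one Y.one) X'.one)
    + (1 / 12 : ℂ) • (d.bracketTwo (d.bracketOne X'.one Y.one) Y.one +
      d.bracketTwo (d.bracketOne X.one Y'.one) Y.one +
      d.bracketTwo (d.bracketOne X.one Y.one) Y'.one) := by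
  rw [bchDeriv]
  simp only [Nil.add_three, Nil.smul_three, Nil.lie_three, Nil.lie_two, Nil.lie_one, map_zero,
    Nil.add_one, Nil.add_two, map_add, LinearMap.add_apply, zero_sub, d.bracketOne_swap Y.one X.one, d.bracketOne_swap Y'.one X.one,
    d.bracketOne_swap Y.one X'.one, map_neg, neg_neg, LinearMap.neg_apply]
  module

/-- The `𝔫₃`-component of the left logarithmic derivative `g⁻¹ dg = X' - ½ [X, X'] + ⅙ [X, [X, X']]`
of `g = exp X` in the direction `X'`. -/
def maurerCartan (X X' : d.Nil) : W :=
  X'.three - (1 / 2 : ℂ) • (d.bracketTwo X.two X'.one - d.bracketTwo X'.two X.one)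
    - (1 / 6 : ℂ) • d.bracketTwo (d.bracketOne X.one X'.one) X.one

/-- The product rule `(gh)⁻¹ d(gh) = Ad(h⁻¹) (g⁻¹ dg) + h⁻¹ dh` in degree three, where
`Ad(exp Y)⁻¹ = 1 - ad Y + ½ (ad Y)²`. -/
theorem maurerCartan_bch (X Y X' Y' : d.Nil) :
    d.maurerCartan (d.bch X Y) (d.bchDeriv X Y X' Y') =
      d.maurerCartan X X' + d.maurerCartan Y Y' - d.bracketTwo Y.two X'.one
      + d.bracketTwo (X'.two - (1 / 2 : ℂ) • d.bracketOne X.one X'.one) Y.one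
      - (1 / 2 : ℂ) • d.bracketTwo (d.bracketOne Y.one X'.one) Y.one := by
  have h1 := N.log_mul_one (N.exp X) (N.exp Y)
  have h2 := N.log_mul_two (N.exp X) (N.exp Y)
  have h3 := N.log_mul_three (N.exp X) (N.exp Y)
  rw [N.log_mul] at h1 h2 h3
  have j (x y z : V ⊗[ℂ] W) : d.bracketTwo (d.bracketOne x z) y =
      d.bracketTwo (d.bracketOne x y) z + d.bracketTwo (d.bracketOne y z) x := by
    have j := d.bracket_jacobi x y z
    rw [d.bracketOne_swap z x, map_neg, LinearMap.neg_apply, ← sub_eq_add_neg] at j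
    exact (sub_eq_zero.1 j).symm
  simp only [maurerCartan, h1, h2, bchDeriv_one, bchDeriv_two, bchDeriv_three,
    map_add, map_sub, map_smul, LinearMap.add_apply, LinearMap.sub_apply, LinearMap.smul_apply]
  simp only [d.bracketOne_swap Y.one X'.one, map_neg, LinearMap.neg_apply]
  rw [j X.one X'.one Y.one, j X.one Y.one Y'.one]
  module

/-- The left logarithmic derivative does not change under left translations. -/
theorem maurerCartan_bch_left (X Y Y' : d.Nil) :
    d.maurerCartan (d.bch X Y) (d.bchDeriv X Y 0 Y') = d.maurerCartan Y Y' := by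
  rw [maurerCartan_bch]
  simp [maurerCartan]

theorem maurerCartan_nilAct (s : SpecialLinearGroup ℂ W) (X X' : d.Nil) :
    d.maurerCartan (d.nilAct s X) (d.nilAct s X') = s • d.maurerCartan X X' := by
  have h (t : ℂ) (w : W) : s • t • w = t • s • w := map_smul (s : W ≃ₗ[ℂ] W) t w
  simp only [maurerCartan, nilAct, bracketOne_act, bracketTwo_act, smul_sub, h]

end MaurerCartan

section Contact

variable {V W : Type*} [NormedAddCommGroup V] [NormedSpace ℂ V] [FiniteDimensional ℂ V]
  [NormedAddCommGroup W] [NormedSpace ℂ W] [Fact (Module.finrank ℂ W = 2)] (d : CubicData V W)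

/-! ### Calculus on the Lie algebra -/

theorem coeff_ext (b : Module.Basis (Fin 2) ℂ W) {x y : V ⊗[ℂ] W}
    (h0 : coeff b 0 x = coeff b 0 y) (h1 : coeff b 1 x = coeff b 1 y) : x = y := by
  have hg : ∀ y : V ⊗[ℂ] W, y = coeff b 0 y ⊗ₜ b 0 + coeff b 1 y ⊗ₜ b 1 := by
    intro y
    induction y with
    | zero => simp
    | add y y' hy hy' =>
      conv_lhs => rw [hy, hy']
      simp only [map_add, TensorProduct.add_tmul]
      abel
    | tmul v w =>
      have hw : w = b.repr w 0 • b 0 + b.repr w 1 • b 1 := by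
        rw [← Fin.sum_univ_two (fun i => b.repr w i • b i), b.sum_repr]
      conv_lhs => rw [hw]
      simp only [coeff_tmul, TensorProduct.tmul_add, TensorProduct.smul_tmul]
  rw [hg x, hg y, h0, h1]

theorem finiteDimensional_plane : FiniteDimensional ℂ W :=
  FiniteDimensional.of_finrank_pos (by rw [(Fact.out : Module.finrank ℂ W = 2)]; norm_num)

/-- A basis of `W`, used only to put a norm on `𝔫`. -/
def auxBasis : Module.Basis (Fin 2) ℂ W :=
  have : FiniteDimensional ℂ W := finiteDimensional_plane
  Module.finBasisOfFinrankEq ℂ W Fact.out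

namespace Nil

variable {d}

/-- Linear coordinates on `𝔫` with values in a normed space. -/
def toModel : d.Nil →ₗ[ℂ] V × V × StrongDual ℂ V × W where
  toFun X := (coeff auxBasis 0 X.one, coeff auxBasis 1 X.one,
    LinearMap.toContinuousLinearMap X.two, X.three)
  map_add' X Y := by simp
  map_smul' t X := by simp

theorem toModel_injective : Function.Injective (toModel (d := d)) := by
  intro X Y h
  obtain ⟨h0, h1, h2, h3⟩ := by simpa only [Prod.ext_iff] using! h
  ext1
  · exact coeff_ext auxBasis h0 h1
  · exact LinearMap.toContinuousLinearMap.injective h2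
  · exact h3

/-- A norm on `𝔫`; since `𝔫` is finite-dimensional, its choice does not matter. -/
instance : NormedAddCommGroup d.Nil :=
  NormedAddCommGroup.induced _ _ toModel toModel_injective

instance : NormedSpace ℂ d.Nil := NormedSpace.induced ℂ _ _ toModel

instance : FiniteDimensional ℂ d.Nil :=
  have : FiniteDimensional ℂ W := finiteDimensional_plane
  FiniteDimensional.of_injective toModel toModel_injective

/-- The Lie bracket of `𝔫` as a continuous bilinear map. -/
def lieL : d.Nil →L[ℂ] d.Nil →L[ℂ] d.Nil :=
  LinearMap.toContinuousBilinearMap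
    (LinearMap.mk₂ ℂ (fun X Y => ⁅X, Y⁆) add_lie smul_lie lie_add (fun c X Y => lie_smul c X Y))

theorem _root_.HasDerivAt.lie {X Y : ℂ → d.Nil} {X' Y' : d.Nil} {t : ℂ} (hX : HasDerivAt X X' t)
    (hY : HasDerivAt Y Y' t) :
    HasDerivAt (fun t => ⁅X t, Y t⁆) (⁅X', Y t⁆ + ⁅X t, Y'⁆) t :=
  (lieL.hasFDerivAt.comp_hasDerivAt t hX).clm_apply hY

theorem contDiff_lie : ContDiff ℂ ω fun p : d.Nil × d.Nil => ⁅p.1, p.2⁆ :=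
  (lieL (d := d)).isBoundedBilinearMap.contDiff

end Nil

theorem hasDerivAt_bch {X Y : ℂ → d.Nil} {X' Y' : d.Nil} {t : ℂ} (hX : HasDerivAt X X' t)
    (hY : HasDerivAt Y Y' t) :
    HasDerivAt (fun t => d.bch (X t) (Y t)) (d.bchDeriv (X t) (Y t) X' Y') t := by
  unfold bch bchDeriv
  exact (((hX.fun_add hY).fun_add ((hX.lie hY).fun_const_smul _)).fun_add
    ((hX.lie (hX.lie hY)).fun_const_smul _)).fun_add ((hY.lie (hY.lie hX)).fun_const_smul _)

theorem contDiff_bch : ContDiff ℂ ω fun p : d.Nil × d.Nil => d.bch p.1 p.2 := by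
  have h1 : ContDiff ℂ ω fun p : d.Nil × d.Nil => p.1 := contDiff_fst
  have h2 : ContDiff ℂ ω fun p : d.Nil × d.Nil => p.2 := contDiff_snd
  have h12 := Nil.contDiff_lie.comp (h1.prodMk h2)
  have h21 := Nil.contDiff_lie.comp (h2.prodMk h1)
  exact (((h1.add h2).add (h12.const_smul _)).add
    ((Nil.contDiff_lie.comp (h1.prodMk h12)).const_smul _)).add
    ((Nil.contDiff_lie.comp (h2.prodMk h21)).const_smul _)

/-! ### Coordinates of `ξ (exp X, ℓ)` -/

/-- The linear map `v ↦ v ⊗ w` from `V` to `𝔫`. -/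
def tmulNil (w : W) : V →L[ℂ] d.Nil :=
  LinearMap.toContinuousLinearMap
    { toFun := fun v => ⟨v ⊗ₜ w, 0, 0⟩
      map_add' := fun u v => by ext1 <;> simp [TensorProduct.add_tmul]
      map_smul' := fun t v => by ext1 <;> simp [TensorProduct.smul_tmul'] }

theorem tmulNil_apply (w : W) (v : V) : d.tmulNil w v = ⟨v ⊗ₜ w, 0, 0⟩ := rfl

/-- `nilOf b` as a continuous linear map. -/
def nilOfL (b : Module.Basis (Fin 2) ℂ W) : Model V W →L[ℂ] d.Nil :=
  have : FiniteDimensional ℂ W := finiteDimensional_plane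
  LinearMap.toContinuousLinearMap
    { toFun := d.nilOf b
      map_add' := fun u v => by ext1 <;> simp [nilOf, TensorProduct.add_tmul]
      map_smul' := fun t v => by ext1 <;> simp [nilOf, TensorProduct.smul_tmul'] }

theorem nilOfL_apply (b : Module.Basis (Fin 2) ℂ W) (e : Model V W) :
    d.nilOfL b e = d.nilOf b e := rfl

/-- `X ↦ coeff b i X.one` as a continuous linear map. -/
def coeffL (b : Module.Basis (Fin 2) ℂ W) (i : Fin 2) : d.Nil →L[ℂ] V :=
  LinearMap.toContinuousLinearMap
    { toFun := fun X => coeff b i X.one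
      map_add' := fun X Y => by simp
      map_smul' := fun t X => by simp }

theorem coeffL_apply (b : Module.Basis (Fin 2) ℂ W) (i : Fin 2) (X : d.Nil) :
    d.coeffL b i X = coeff b i X.one := rfl

/-- The projection `𝔫 → 𝔫₂` as a continuous linear map. -/
def twoL : d.Nil →L[ℂ] StrongDual ℂ V :=
  LinearMap.toContinuousLinearMap
    { toFun := fun X => LinearMap.toContinuousLinearMap X.two
      map_add' := fun X Y => by simp
      map_smul' := fun t X => by simp }

/-- The projection `𝔫 → 𝔫₃` as a continuous linear map. -/
def threeL : d.Nil →L[ℂ] W :=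
  LinearMap.toContinuousLinearMap
    { toFun := fun X => X.three
      map_add' := fun _ _ => rfl
      map_smul' := fun _ _ => rfl }

/-- The element `Z` of `𝔞_ℓ`, `ℓ = [b₀ + z b₁]`, for which `exp X · exp Z` has no component along
`V ⊗ b₀`. -/
def corr (b : Module.Basis (Fin 2) ℂ W) (X : d.Nil) (z : ℂ) : d.Nil :=
  -(d.tmulNil (b 0) (d.coeffL b 0 X) + z • d.tmulNil (b 1) (d.coeffL b 0 X))

theorem corr_eq (b : Module.Basis (Fin 2) ℂ W) (X : d.Nil) (z : ℂ) :
    d.corr b X z = ⟨(-coeff b 0 X.one) ⊗ₜ (b 0 + z • b 1), 0, 0⟩ := by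
  ext1 <;> simp [corr, tmulNil_apply, coeffL_apply, TensorProduct.tmul_add,
    TensorProduct.neg_tmul]
  abel

theorem contDiff_corr (b : Module.Basis (Fin 2) ℂ W) :
    ContDiff ℂ ω fun p : d.Nil × ℂ => d.corr b p.1 p.2 := by
  unfold corr
  fun_prop

theorem hasDerivAt_corr (b : Module.Basis (Fin 2) ℂ W) {X : ℂ → d.Nil} {z : ℂ → ℂ} {X' : d.Nil}
    {z' t : ℂ} (hX : HasDerivAt X X' t) (hz : HasDerivAt z z' t) :
    HasDerivAt (fun t => d.corr b (X t) (z t))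
      ⟨(-coeff b 0 X'.one) ⊗ₜ (b 0 + z t • b 1) + (-z' • coeff b 0 (X t).one) ⊗ₜ b 1, 0, 0⟩ t := by
  have h (w : W) : HasDerivAt (fun t => d.tmulNil w (d.coeffL b 0 (X t)))
      (d.tmulNil w (d.coeffL b 0 X')) t :=
    ((d.tmulNil w).comp (d.coeffL b 0)).hasFDerivAt.comp_hasDerivAt t hX
  unfold corr
  have h2 : HasDerivAt (fun t => z t • d.tmulNil (b 1) (d.coeffL b 0 (X t)))
      (z t • d.tmulNil (b 1) (d.coeffL b 0 X') + z' • d.tmulNil (b 1) (d.coeffL b 0 (X t))) t :=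
    hz.fun_smul (h (b 1))
  have h3 := ((h (b 0)).fun_add h2).fun_neg
  refine h3.congr_deriv ?_
  ext1 <;> simp [tmulNil_apply, coeffL_apply, TensorProduct.tmul_add,
    TensorProduct.neg_tmul, TensorProduct.smul_tmul']
  abel

/-- The coordinates of `ξ (exp X, [b₀ + z b₁])` for the parametrization given by `b`. -/
def coords (b : Module.Basis (Fin 2) ℂ W) (p : d.Nil × ℂ) : Model V W :=
  (d.coeffL b 1 (d.bch p.1 (d.corr b p.1 p.2)), d.twoL (d.bch p.1 (d.corr b p.1 p.2)),
    d.threeL (d.bch p.1 (d.corr b p.1 p.2)), p.2)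

theorem contDiff_coords (b : Module.Basis (Fin 2) ℂ W) : ContDiff ℂ ω (d.coords b) := by
  have h : ContDiff ℂ ω fun p : d.Nil × ℂ => d.bch p.1 (d.corr b p.1 p.2) :=
    d.contDiff_bch.comp (f := fun p : d.Nil × ℂ => (p.1, d.corr b p.1 p.2))
      (contDiff_fst.prodMk (d.contDiff_corr b))
  unfold coords
  fun_prop

theorem nilOf_coords (b : Module.Basis (Fin 2) ℂ W) (X : d.Nil) (z : ℂ) :
    d.nilOf b (d.coords b (X, z)) = d.bch X (d.corr b X z) := by
  have h1 : (d.bch X (d.corr b X z)).one = X.one + (d.corr b X z).one :=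
    N.log_mul_one (N.exp X) (N.exp _)
  ext1
  · change coeff b 1 (d.bch X (d.corr b X z)).one ⊗ₜ[ℂ] b 1 = (d.bch X (d.corr b X z)).one
    apply coeff_ext b
    · rw [h1]
      simp only [map_add, corr_eq, coeff_tmul]
      simp
    · rw [coeff_tmul]
      simp
  · rfl
  · rfl

theorem param_coords (b : Module.Basis (Fin 2) ℂ W) (X : d.Nil) (z : ℂ) :
    d.param b (d.coords b (X, z)) = d.ξ (N.exp X) (ProjLine.param b z) := by
  refine (d.ξ_eq_iff _ _ _ _).2 ⟨rfl, ?_⟩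
  rw [nilOf_coords]
  change (N.exp X * N.exp (d.corr b X z))⁻¹ * N.exp X ∈ _
  rw [mul_inv_rev, mul_assoc, inv_mul_cancel, mul_one, corr_eq]
  exact inv_mem ⟨tmul_mem b _ _, rfl, rfl⟩

/-! ### The contact form in coordinates -/

/-- The part of the contact form that does not depend on the base point. -/
def contactFormConst (b : Module.Basis (Fin 2) ℂ W) : Model V W →ₗ[ℂ] ℂ where
  toFun e' := d.form e'.2.2.1 (b 0)
  map_add' e e' := by simp
  map_smul' t e' := by simp

/-- The part of the contact form that depends on the base point, bilinear in the base point and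
the tangent vector. -/
def contactFormLin (b : Module.Basis (Fin 2) ℂ W) : Model V W →ₗ[ℂ] Model V W →ₗ[ℂ] ℂ :=
  LinearMap.mk₂ ℂ (fun e e' : Model V W => e.2.2.2 * d.form e'.2.2.1 (b 1)
      - (1 / 2) * (e.2.1 e'.1 - e'.2.1 e.1) * d.form (b 1) (b 0))
      (fun e₁ e₂ e' => by simp; ring) (fun t e e' => by simp; ring)
      (fun e e₁ e₂ => by simp; ring) (fun t e e' => by simp; ring)

/-- The contact form `ω(dw, l + z m) - ½ (f(dv) - df(v)) ω(m, l)` in the coordinates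
`(v, f, w, z)` given by the basis `b = (l, m)`. -/
def contactForm (b : Module.Basis (Fin 2) ℂ W) (e : Model V W) :=
  have : FiniteDimensional ℂ W := finiteDimensional_plane
  affineForm (E := Model V W) (d.contactFormConst b) (d.contactFormLin b) e

theorem contactFormLin_apply (b : Module.Basis (Fin 2) ℂ W) (e e' : Model V W) :
    d.contactFormLin b e e' = e.2.2.2 * d.form e'.2.2.1 (b 1)
      - (1 / 2) * (e.2.1 e'.1 - e'.2.1 e.1) * d.form (b 1) (b 0) := rfl

theorem contactForm_apply (b : Module.Basis (Fin 2) ℂ W) (e e' : Model V W) :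
    d.contactForm b e e' = d.form e'.2.2.1 (b 0 + e.2.2.2 • b 1)
      - (1 / 2) * (e.2.1 e'.1 - e'.2.1 e.1) * d.form (b 1) (b 0) := by
  change d.form e'.2.2.1 (b 0) + d.contactFormLin b e e' = _
  rw [contactFormLin_apply, map_add, map_smul, smul_eq_mul]
  ring

theorem contDiff_contactForm_apply (b : Module.Basis (Fin 2) ℂ W) :
    ContDiff ℂ ω fun p : Model V W × Model V W => d.contactForm b p.1 p.2 :=
  have : FiniteDimensional ℂ W := finiteDimensional_plane
  contDiff_affineForm_apply (E := Model V W) (d.contactFormConst b) (d.contactFormLin b)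

theorem contactForm_eq_maurerCartan (b : Module.Basis (Fin 2) ℂ W) (e e' : Model V W) :
    d.contactForm b e e' =
      d.form (d.maurerCartan (d.nilOf b e) (d.nilOf b e')) (b 0 + e.2.2.2 • b 1) := by
  rw [contactForm_apply]
  simp [maurerCartan, nilOf, d.form_self]
  ring

/-- The value of `ω(g⁻¹ dg, ·)` on `ℓ̂` depends only on the image of the curve `exp X` in `N / A_ℓ`,
even if `ℓ` varies: correcting `exp X` by a curve in the groups `A_ℓ` changes the `𝔫₃`-component
of the left logarithmic derivative only by elements of `ℓ̂`. -/
theorem form_maurerCartan_bch (X X' : d.Nil) (u u' u'' : V) (w m : W) :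
    d.form (d.maurerCartan (d.bch X ⟨u ⊗ₜ w, 0, 0⟩)
      (d.bchDeriv X ⟨u ⊗ₜ w, 0, 0⟩ X' ⟨u' ⊗ₜ w + u'' ⊗ₜ m, 0, 0⟩)) w =
      d.form (d.maurerCartan X X') w := by
  have h (f : Module.Dual ℂ V) : d.form (d.bracketTwo f (u ⊗ₜ w)) w = 0 := by
    simp [d.form_self]
  have h' : d.form (d.maurerCartan ⟨u ⊗ₜ w, 0, 0⟩ ⟨u' ⊗ₜ w + u'' ⊗ₜ m, 0, 0⟩) w = 0 := by
    simp [maurerCartan, d.form_self]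
  rw [maurerCartan_bch]
  simp only [map_add, map_sub, map_smul, LinearMap.add_apply, LinearMap.sub_apply,
    LinearMap.smul_apply, h, h', map_zero, LinearMap.zero_apply]
  simp

/-- A curve `ξ (exp X, ℓ)` in `X_c` is differentiable in the coordinates given by `b`, and the
contact form takes the value `ω(g⁻¹ dg, l + z m)` on its velocity, for `g = exp X`. -/
theorem exists_coords_curve (b : Module.Basis (Fin 2) ℂ W) {X : ℂ → d.Nil} {X' : d.Nil} {t : ℂ}
    {ℓ : ℂ → ℙ ℂ W} (hX : HasDerivAt X X' t) (hℓ : MDifferentiableAt 𝓘(ℂ, ℂ) 𝓘(ℂ, ℂ) ℓ t)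
    (hb : ℓ t ∈ Set.range (ProjLine.param b)) :
    ∃ (e : ℂ → Model V W) (e' : Model V W), HasDerivAt e e' t ∧
      (fun s => d.ξ (N.exp (X s)) (ℓ s)) =ᶠ[nhds t] (fun s => d.param b (e s)) ∧
      d.contactForm b (e t) e' = d.form (d.maurerCartan (X t) X') (b 0 + (e t).2.2.2 • b 1) := by
  obtain ⟨z, hz⟩ : ∃ z : ℂ → ℂ, z = fun s => Function.invFun (ProjLine.param b) (ℓ s) := ⟨_, rfl⟩
  have hU := (ProjLine.isOpen_range_param b).mem_nhds hb
  have hzd : HasDerivAt z (deriv z t) t := by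
    have h1 := ((ProjLine.contMDiffOn_invFun_param b).contMDiffAt hU).mdifferentiableAt
      (by simp)
    have h2 := h1.comp t hℓ
    rw [mdifferentiableAt_iff_differentiableAt] at h2
    rw [hz]
    exact h2.hasDerivAt
  have hzeq : ∀ᶠ s in nhds t, ProjLine.param b (z s) = ℓ s := by
    filter_upwards [hℓ.continuousAt.preimage_mem_nhds hU] with s hs
    rw [hz]
    exact Function.invFun_eq hs
  have he : HasDerivAt (fun s => d.coords b (X s, z s))
      (deriv (fun s => d.coords b (X s, z s)) t) t := by
    have h1 : DifferentiableAt ℂ (d.coords b) (X t, z t) :=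
      (d.contDiff_coords b).differentiable (by simp) _
    have h2 := h1.comp (f := fun s => (X s, z s)) t
      (hX.differentiableAt.prodMk hzd.differentiableAt)
    exact h2.hasDerivAt
  refine ⟨_, _, he, ?_, ?_⟩
  · filter_upwards [hzeq] with s hs
    rw [param_coords, hs]
  · have h1 := (d.nilOfL b).hasFDerivAt.comp_hasDerivAt t he
    have h2 : (d.nilOfL b) ∘ (fun s => d.coords b (X s, z s)) =
        fun s => d.bch (X s) (d.corr b (X s) (z s)) := by
      funext s
      exact d.nilOf_coords b _ _
    rw [h2] at h1
    have hn := h1.unique (d.hasDerivAt_bch hX (d.hasDerivAt_corr b hX hzd))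
    rw [nilOfL_apply] at hn
    rw [contactForm_eq_maurerCartan, hn, nilOf_coords, corr_eq]
    exact d.form_maurerCartan_bch _ _ _ _ _ _ _

/-! ### Charts of `X_c` -/

/-- The coordinates on `X_c` given by the basis `b`, the inverse of `param b`. -/
def chartMap (b : Module.Basis (Fin 2) ℂ W) : d.X → Model V W := Function.invFun (d.param b)

theorem chartMap_param (b : Module.Basis (Fin 2) ℂ W) (e : Model V W) :
    d.chartMap b (d.param b e) = e :=
  Function.leftInverse_invFun (d.param_injective b) e

theorem param_chartMap (b : Module.Basis (Fin 2) ℂ W) {x : d.X}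
    (hx : x ∈ Set.range (d.param b)) : d.param b (d.chartMap b x) = x :=
  Function.invFun_eq hx

theorem isOpen_range_param (b : Module.Basis (Fin 2) ℂ W) : IsOpen (Set.range (d.param b)) :=
  d.atlas.isOpen_range b

theorem contMDiff_param (b : Module.Basis (Fin 2) ℂ W) :
    ContMDiff 𝓘(ℂ, Model V W) 𝓘(ℂ, Model V W) ω (d.param b) :=
  d.atlas.contMDiff_param b

theorem mdifferentiableAt_param (b : Module.Basis (Fin 2) ℂ W) (e : Model V W) :
    MDifferentiableAt 𝓘(ℂ, Model V W) 𝓘(ℂ, Model V W) (d.param b) e :=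
  (d.contMDiff_param b e).mdifferentiableAt (by simp)

theorem contMDiffOn_chartMap (b : Module.Basis (Fin 2) ℂ W) :
    ContMDiffOn 𝓘(ℂ, Model V W) 𝓘(ℂ, Model V W) ω (d.chartMap b) (Set.range (d.param b)) :=
  d.atlas.contMDiffOn_chart b

theorem mdifferentiableAt_chartMap (b : Module.Basis (Fin 2) ℂ W) {x : d.X}
    (hx : x ∈ Set.range (d.param b)) :
    MDifferentiableAt 𝓘(ℂ, Model V W) 𝓘(ℂ, Model V W) (d.chartMap b) x :=
  ((d.contMDiffOn_chartMap b).contMDiffAt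
    ((d.isOpen_range_param b).mem_nhds hx)).mdifferentiableAt (by simp)

theorem mfderiv_chartMap_param (b : Module.Basis (Fin 2) ℂ W) (e e' : Model V W) :
    mfderiv 𝓘(ℂ, Model V W) 𝓘(ℂ, Model V W) (d.chartMap b) (d.param b e)
      (mfderiv 𝓘(ℂ, Model V W) 𝓘(ℂ, Model V W) (d.param b) e e') = e' := by
  have h1 := mfderiv_comp_apply e (d.mdifferentiableAt_chartMap b ⟨e, rfl⟩)
    (d.mdifferentiableAt_param b e) e'
  have h2 : d.chartMap b ∘ d.param b = id := funext (d.chartMap_param b)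
  rw [h2, mfderiv_id] at h1
  exact h1.symm

/-- Every tangent vector of `X_c` at `param b e` is the image of a vector of coordinates. -/
theorem exists_mfderiv_param (b : Module.Basis (Fin 2) ℂ W) (e : Model V W)
    (v : TangentSpace 𝓘(ℂ, Model V W) (d.param b e)) :
    ∃ e' : Model V W, mfderiv 𝓘(ℂ, Model V W) 𝓘(ℂ, Model V W) (d.param b) e e' = v := by
  refine ⟨mfderiv 𝓘(ℂ, Model V W) 𝓘(ℂ, Model V W) (d.chartMap b) (d.param b e) v, ?_⟩
  have hx : d.param b e ∈ Set.range (d.param b) := ⟨e, rfl⟩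
  have h0 := d.mdifferentiableAt_param b (d.chartMap b (d.param b e))
  have h1 := mfderiv_comp_apply (d.param b e) h0 (d.mdifferentiableAt_chartMap b hx) v
  have h2 : d.param b ∘ d.chartMap b =ᶠ[nhds (d.param b e)] id := by
    filter_upwards [(d.isOpen_range_param b).mem_nhds hx] with y hy
    exact d.param_chartMap b hy
  rw [h2.mfderiv_eq, mfderiv_id] at h1
  rw [chartMap_param] at h1
  exact h1.symm

theorem fst_mem_range (b : Module.Basis (Fin 2) ℂ W) {x : d.X}
    (hx : x ∈ Set.range (d.param b)) : x.1 ∈ Set.range (ProjLine.param b) := by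
  obtain ⟨e, rfl⟩ := hx
  exact ⟨_, rfl⟩

/-! ### The invariant form with values in `L` -/

/-- The form on `X_c` with values in `L`, whose fibre at `x` is the dual of the line `x.1`. In the coordinates `(v, f, w, z)` of a basis `b`, it is
the contact form multiplied by the section of `L` that maps `b₀ + z b₁` to `1`. -/
def theta (x : d.X) : TangentSpace 𝓘(ℂ, Model V W) x →L[ℂ] O1 x.1 :=
  ContinuousLinearMap.smulRight
    ((d.contactForm (d.atlas.idx x) (d.chartMap (d.atlas.idx x) x)).comp
      (mfderiv 𝓘(ℂ, Model V W) 𝓘(ℂ, Model V W) (d.chartMap (d.atlas.idx x)) x))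
    (cofun (d.atlas.idx x) x.1)

/-- The velocity of a curve `ξ (exp X, ℓ)` is mapped by `theta` to the restriction of
`ω(g⁻¹ dg, ·)` to `ℓ̂`, for `g = exp X`. This description of `theta` does not refer to coordinates. -/
theorem theta_curve {X : ℂ → d.Nil} {X' : d.Nil} {t : ℂ} {ℓ : ℂ → ℙ ℂ W} (hX : HasDerivAt X X' t)
    (hℓ : MDifferentiableAt 𝓘(ℂ, ℂ) 𝓘(ℂ, ℂ) ℓ t) :
    MDifferentiableAt 𝓘(ℂ, ℂ) 𝓘(ℂ, Model V W) (fun s => d.ξ (N.exp (X s)) (ℓ s)) t ∧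
    ∀ w : (ℓ t).submodule, d.theta (d.ξ (N.exp (X t)) (ℓ t)) (mfderiv 𝓘(ℂ, ℂ) 𝓘(ℂ, Model V W)
      (fun s => d.ξ (N.exp (X s)) (ℓ s)) t (1 : ℂ)) w =
      d.form (d.maurerCartan (X t) X') w := by
  obtain ⟨b, hb⟩ : ∃ b, b = d.atlas.idx (d.ξ (N.exp (X t)) (ℓ t)) := ⟨_, rfl⟩
  have hmem : d.ξ (N.exp (X t)) (ℓ t) ∈ Set.range (d.param b) := by
    rw [hb]
    exact d.atlas.mem_range _
  have hℓb : ℓ t ∈ Set.range (ProjLine.param b) := d.fst_mem_range b hmem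
  obtain ⟨e, e', he, hγ, hform⟩ := d.exists_coords_curve b hX hℓ hℓb
  have hed : MDifferentiableAt 𝓘(ℂ, ℂ) 𝓘(ℂ, Model V W) e t :=
    he.differentiableAt.mdifferentiableAt
  have hγd : MDifferentiableAt 𝓘(ℂ, ℂ) 𝓘(ℂ, Model V W) (fun s => d.ξ (N.exp (X s)) (ℓ s)) t :=
    ((d.mdifferentiableAt_param b (e t)).comp t hed).congr_of_eventuallyEq hγ
  refine ⟨hγd, fun w => ?_⟩
  have hγt : d.ξ (N.exp (X t)) (ℓ t) = d.param b (e t) := hγ.eq_of_nhds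
  have hchart : d.chartMap b (d.ξ (N.exp (X t)) (ℓ t)) = e t := by rw [hγt, chartMap_param]
  have hderiv : mfderiv 𝓘(ℂ, Model V W) 𝓘(ℂ, Model V W) (d.chartMap b)
      (d.ξ (N.exp (X t)) (ℓ t)) (mfderiv 𝓘(ℂ, ℂ) 𝓘(ℂ, Model V W)
        (fun s => d.ξ (N.exp (X s)) (ℓ s)) t (1 : ℂ)) = e' := by
    have h1 := mfderiv_comp_apply t (d.mdifferentiableAt_chartMap b hmem) hγd (1 : ℂ)
    have h2 : d.chartMap b ∘ (fun s => d.ξ (N.exp (X s)) (ℓ s)) =ᶠ[nhds t] e := by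
      filter_upwards [hγ] with s hs
      rw [Function.comp_apply, hs, chartMap_param]
    rw [h2.mfderiv_eq, mfderiv_eq_fderiv] at h1
    refine h1.symm.trans ?_
    rw [he.hasFDerivAt.fderiv]
    exact one_smul ℂ e'
  have htheta (v : TangentSpace 𝓘(ℂ, Model V W) (d.ξ (N.exp (X t)) (ℓ t))) :
      d.theta (d.ξ (N.exp (X t)) (ℓ t)) v w =
        d.contactForm b (d.chartMap b (d.ξ (N.exp (X t)) (ℓ t)))
          (mfderiv 𝓘(ℂ, Model V W) 𝓘(ℂ, Model V W) (d.chartMap b) (d.ξ (N.exp (X t)) (ℓ t)) v) *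
        cofun b (ℓ t) w := by
    rw [hb]
    rfl
  rw [htheta, hderiv, hchart, hform]
  have hz : ℓ t = ProjLine.param b (e t).2.2.2 := congrArg Sigma.fst hγt
  have hw : (w : W) = cofun b (ℓ t) w • (b 0 + (e t).2.2.2 • b 1) := by
    have h1 := congrArg (Subtype.val) (eq_smul_gen b (ℓ t) hℓb w)
    have h2 : (gen b (ℓ t) : W) = b 0 + (e t).2.2.2 • b 1 := by rw [hz, gen_param]
    rw [← h2]
    exact h1
  conv_rhs => rw [hw]
  rw [map_smul, smul_eq_mul, mul_comm]

/-! ### Invariance under the group `G` -/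

theorem mfderiv_param_curve (b : Module.Basis (Fin 2) ℂ W) {e : ℂ → Model V W} {e' : Model V W}
    {t : ℂ} (he : HasDerivAt e e' t) :
    mfderiv 𝓘(ℂ, ℂ) 𝓘(ℂ, Model V W) (fun s => d.param b (e s)) t (1 : ℂ) =
      mfderiv 𝓘(ℂ, Model V W) 𝓘(ℂ, Model V W) (d.param b) (e t) e' := by
  have hed : MDifferentiableAt 𝓘(ℂ, ℂ) 𝓘(ℂ, Model V W) e t :=
    he.differentiableAt.mdifferentiableAt
  have h1 := mfderiv_comp_apply t (d.mdifferentiableAt_param b (e t)) hed (1 : ℂ)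
  rw [mfderiv_eq_fderiv (f := e), he.hasFDerivAt.fderiv] at h1
  refine h1.trans (congrArg (mfderiv 𝓘(ℂ, Model V W) 𝓘(ℂ, Model V W) (d.param b) (e t)) ?_)
  exact one_smul ℂ e'

theorem hasDerivAt_nilOf (b : Module.Basis (Fin 2) ℂ W) {e : ℂ → Model V W} {e' : Model V W}
    {t : ℂ} (he : HasDerivAt e e' t) :
    HasDerivAt (fun s => d.nilOf b (e s)) (d.nilOf b e') t :=
  (d.nilOfL b).hasFDerivAt.comp_hasDerivAt t he

theorem mdifferentiableAt_param_curve (b : Module.Basis (Fin 2) ℂ W) {e : ℂ → Model V W}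
    {e' : Model V W} {t : ℂ} (he : HasDerivAt e e' t) :
    MDifferentiableAt 𝓘(ℂ, ℂ) 𝓘(ℂ, ℂ) (fun s => ProjLine.param b (e s).2.2.2) t := by
  have h1 : DifferentiableAt ℂ (fun s => (e s).2.2.2) t :=
    he.differentiableAt.snd.snd.snd
  exact ((ProjLine.contMDiff_param b _).mdifferentiableAt (by simp)).comp t
    h1.mdifferentiableAt

/-- The expression of `theta` in the coordinates given by any basis `b`. -/
theorem theta_param (b : Module.Basis (Fin 2) ℂ W) (e e' : Model V W)
    (w : (ProjLine.param b e.2.2.2).submodule) :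
    d.theta (d.param b e) (mfderiv 𝓘(ℂ, Model V W) 𝓘(ℂ, Model V W) (d.param b) e e') w =
      d.form (d.maurerCartan (d.nilOf b e) (d.nilOf b e')) w := by
  obtain ⟨c, rfl, hc⟩ := exists_curve e e'
  have h := (d.theta_curve (d.hasDerivAt_nilOf b hc) (mdifferentiableAt_param_curve b hc)).2 w
  rw [← h, ← d.mfderiv_param_curve b hc]
  rfl

/-- The action of `SL(W)` on `𝔫` as a continuous linear map. -/
def nilActL (s : SpecialLinearGroup ℂ W) : d.Nil →L[ℂ] d.Nil :=
  LinearMap.toContinuousLinearMap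
    { toFun := d.nilAct s
      map_add' := fun X Y => by
        ext1
        · exact map_add _ _ _
        · rfl
        · exact smul_add _ _ _
      map_smul' := fun t X => by
        ext1
        · exact map_smul _ _ _
        · rfl
        · exact map_smul (s : W ≃ₗ[ℂ] W) t X.three }

/-- The action of `(exp n, s)` maps the coordinates given by `b` to those given by `s b`. -/
theorem smul_param (a : d.G) (b : Module.Basis (Fin 2) ℂ W) (e : Model V W) :
    a • d.param b e = d.param (b.map (a.right : W ≃ₗ[ℂ] W))
      (d.coords (b.map (a.right : W ≃ₗ[ℂ] W))
        (d.bch a.left.log (d.nilActL a.right (d.nilOfL b e)), e.2.2.2)) := by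
  rw [param_coords, ← ProjLine.smul_param]
  rfl

theorem mdifferentiableAt_smul (a : d.G) (x : d.X) :
    MDifferentiableAt 𝓘(ℂ, Model V W) 𝓘(ℂ, Model V W) (fun y : d.X => a • y) x := by
  obtain ⟨b, hb⟩ : ∃ b, x ∈ Set.range (d.param b) := ⟨_, d.atlas.mem_range x⟩
  have h1 : ContDiff ℂ ω fun e : Model V W =>
      d.bch a.left.log (d.nilActL a.right (d.nilOfL b e)) :=
    d.contDiff_bch.comp
      (f := fun e : Model V W => (a.left.log, d.nilActL a.right (d.nilOfL b e)))
      (contDiff_const.prodMk ((d.nilActL a.right).comp (d.nilOfL b)).contDiff)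
  have h2 : ContDiff ℂ ω fun e : Model V W => d.coords (b.map (a.right : W ≃ₗ[ℂ] W))
      (d.bch a.left.log (d.nilActL a.right (d.nilOfL b e)), e.2.2.2) :=
    (d.contDiff_coords _).comp
      (f := fun e : Model V W => (d.bch a.left.log (d.nilActL a.right (d.nilOfL b e)), e.2.2.2))
      (h1.prodMk (by fun_prop))
  have h3 := ((d.contMDiff_param (b.map (a.right : W ≃ₗ[ℂ] W))).comp h2.contMDiff)
  have h4 := ((h3 (d.chartMap b x)).mdifferentiableAt (by simp)).comp x
    (d.mdifferentiableAt_chartMap b hb)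
  refine h4.congr_of_eventuallyEq ?_
  filter_upwards [(d.isOpen_range_param b).mem_nhds hb] with y hy
  obtain ⟨e, rfl⟩ := hy
  simp only [Function.comp_apply, chartMap_param]
  exact d.smul_param a b e

/-- `theta` is invariant under the action of `G` on `X_c` and on `L`. -/
theorem theta_smul (a : d.G) (x : d.X) (v : TangentSpace 𝓘(ℂ, Model V W) x) (w : x.1.submodule)
    (w' : (a • x).1.submodule) (h : (w' : W) = a.right • (w : W)) :
    d.theta (a • x)
      (mfderiv 𝓘(ℂ, Model V W) 𝓘(ℂ, Model V W) (fun y : d.X => a • y) x v) w' =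
      d.theta x v w := by
  obtain ⟨b, hb⟩ : ∃ b, x ∈ Set.range (d.param b) := ⟨_, d.atlas.mem_range x⟩
  obtain ⟨e, rfl⟩ := hb
  obtain ⟨e', rfl⟩ := d.exists_mfderiv_param b e v
  refine Eq.trans ?_ (d.theta_param b e e' w).symm
  obtain ⟨c, rfl, hc⟩ := exists_curve e e'
  have hX : HasDerivAt (fun s => d.bch a.left.log (d.nilAct a.right (d.nilOf b (c s))))
      (d.bchDeriv a.left.log (d.nilAct a.right (d.nilOf b (c 0))) 0
        (d.nilAct a.right (d.nilOf b e'))) 0 :=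
    d.hasDerivAt_bch (hasDerivAt_const _ _)
      ((d.nilActL a.right).hasFDerivAt.comp_hasDerivAt 0 (d.hasDerivAt_nilOf b hc))
  have hℓ : MDifferentiableAt 𝓘(ℂ, ℂ) 𝓘(ℂ, ℂ)
      (fun s => a.right • ProjLine.param b (c s).2.2.2) 0 := by
    simp only [ProjLine.smul_param]
    exact mdifferentiableAt_param_curve _ hc
  have h1 := (d.theta_curve hX hℓ).2 w'
  rw [maurerCartan_bch_left, maurerCartan_nilAct, h, form_map] at h1
  refine Eq.trans ?_ h1
  have hγ : MDifferentiableAt 𝓘(ℂ, ℂ) 𝓘(ℂ, Model V W) (fun s => d.param b (c s)) 0 :=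
    (d.mdifferentiableAt_param b (c 0)).comp 0 hc.differentiableAt.mdifferentiableAt
  have h2 := mfderiv_comp_apply 0 (d.mdifferentiableAt_smul a (d.param b (c 0))) hγ (1 : ℂ)
  refine congrArg (fun v => d.theta (a • d.param b (c 0)) v w') (Eq.trans ?_ h2.symm)
  exact congrArg _ (d.mfderiv_param_curve b hc).symm

/-! ### The invariant distribution -/

/-- The kernel of `theta`. -/
def contactDistribution : TangentDistribution (Model V W) d.X :=
  fun x => LinearMap.ker (d.theta x).toLinearMap

theorem mem_contactDistribution (x : d.X) (v : TangentSpace 𝓘(ℂ, Model V W) x) :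
    v ∈ d.contactDistribution x ↔ ∀ w : x.1.submodule, d.theta x v w = 0 := by
  refine LinearMap.mem_ker.trans ⟨fun h w => ?_, fun h => ?_⟩
  · exact congrArg (fun l : O1 x.1 => l w) h
  · exact ContinuousLinearMap.ext h

theorem smul_mem_submodule (s : SpecialLinearGroup ℂ W) (ℓ : ℙ ℂ W) {w : W}
    (hw : w ∈ ℓ.submodule) : s • w ∈ (s • ℓ).submodule := by
  induction ℓ with
  | h u hu =>
    rw [Projectivization.smul_mk, Projectivization.submodule_mk]
    rw [Projectivization.submodule_mk] at hw
    obtain ⟨t, rfl⟩ := Submodule.mem_span_singleton.1 hw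
    exact Submodule.mem_span_singleton.2 ⟨t, (map_smul (s : W ≃ₗ[ℂ] W) t u).symm⟩

theorem mfderiv_smul_mem_iff (a : d.G) (x : d.X) (v : TangentSpace 𝓘(ℂ, Model V W) x) :
    mfderiv 𝓘(ℂ, Model V W) 𝓘(ℂ, Model V W) (fun y : d.X => a • y) x v ∈
      d.contactDistribution (a • x) ↔ v ∈ d.contactDistribution x := by
  refine (d.mem_contactDistribution (a • x) _).trans
    (Iff.trans ⟨fun h w => ?_, fun h w' => ?_⟩ (d.mem_contactDistribution x v).symm)
  · have hw : a.right • (w : W) ∈ (a • x).1.submodule := smul_mem_submodule a.right x.1 w.2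
    exact (d.theta_smul a x v w ⟨_, hw⟩ rfl).symm.trans (h ⟨_, hw⟩)
  · have hw : a.right⁻¹ • (w' : W) ∈ x.1.submodule := by
      have h1 := smul_mem_submodule a.right⁻¹ (a.right • x.1) w'.2
      rwa [inv_smul_smul] at h1
    exact (d.theta_smul a x v ⟨_, hw⟩ w' (smul_inv_smul a.right (w' : W)).symm).trans (h ⟨_, hw⟩)

theorem mfderiv_smul_injective (a : d.G) (x : d.X) : Function.Injective
    (mfderiv 𝓘(ℂ, Model V W) 𝓘(ℂ, Model V W) (fun y : d.X => a • y) x) := by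
  have h2 : (fun y : d.X => a⁻¹ • y) ∘ (fun y : d.X => a • y) = id :=
    funext fun y => inv_smul_smul a y
  have h (v : TangentSpace 𝓘(ℂ, Model V W) x) : v =
      mfderiv 𝓘(ℂ, Model V W) 𝓘(ℂ, Model V W) (fun y : d.X => a⁻¹ • y) (a • x)
        (mfderiv 𝓘(ℂ, Model V W) 𝓘(ℂ, Model V W) (fun y : d.X => a • y) x v) := by
    have h1 := mfderiv_comp_apply x
      (d.mdifferentiableAt_smul a⁻¹ (a • x)) (d.mdifferentiableAt_smul a x) v
    rw [h2, mfderiv_id] at h1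
    exact h1
  intro v v' hv
  exact (h v).trans ((congrArg (mfderiv 𝓘(ℂ, Model V W) 𝓘(ℂ, Model V W)
    (fun y : d.X => a⁻¹ • y) (a • x)) hv).trans (h v').symm)

theorem isInvariant_contactDistribution : d.IsInvariant d.contactDistribution := by
  intro a x
  refine ⟨d.mdifferentiableAt_smul a x, ?_⟩
  have : FiniteDimensional ℂ W := finiteDimensional_plane
  have hsurj : Function.Surjective
      (mfderiv 𝓘(ℂ, Model V W) 𝓘(ℂ, Model V W) (fun y : d.X => a • y) x) :=
    surjective_of_injective (E := Model V W) _ (d.mfderiv_smul_injective a x)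
  ext v
  constructor
  · intro hv
    obtain ⟨u, rfl⟩ := hsurj v
    exact ⟨u, (d.mfderiv_smul_mem_iff a x u).1 hv, rfl⟩
  · rintro ⟨u, hu, rfl⟩
    exact (d.mfderiv_smul_mem_iff a x u).2 hu

theorem exists_smul_basePoint (ℓ : ℙ ℂ W) (x : d.X) : ∃ a : d.G, a • d.basePoint ℓ = x := by
  obtain ⟨g, m, rfl⟩ := d.ξ_surj x
  have : MulAction.IsPretransitive (SpecialLinearGroup ℂ W) (ℙ ℂ W) :=
    MulAction.isPretransitive_of_is_two_pretransitive
  obtain ⟨s, rfl⟩ := MulAction.exists_smul_eq (SpecialLinearGroup ℂ W) ℓ m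
  refine ⟨⟨g, s⟩, ?_⟩
  rw [basePoint, smul_ξ]
  have h : d.grpAct s 1 = 1 := map_one (d.autHom s)
  change d.ξ (g * d.grpAct s 1) (s • ℓ) = _
  rw [h, mul_one]

/-- Since `G` acts transitively, an invariant distribution is determined by its value at a
point. -/
theorem eq_of_isInvariant {D D' : TangentDistribution (Model V W) d.X} (hD : d.IsInvariant D)
    (hD' : d.IsInvariant D') (ℓ : ℙ ℂ W) (h : D' (d.basePoint ℓ) = D (d.basePoint ℓ)) :
    D' = D := by
  funext x
  obtain ⟨a, rfl⟩ := d.exists_smul_basePoint ℓ x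
  rw [(hD' a (d.basePoint ℓ)).2, (hD a (d.basePoint ℓ)).2, h]

/-! ### The value at the base point -/

theorem exists_form_ne_zero {w : W} (hw : w ≠ 0) : ∃ u, d.form w u ≠ 0 := by
  by_contra! h
  apply d.form_ne_zero
  ext a b
  have h1 := d.form_cyclic a b w
  rw [h a, d.form_swap b w, h b, neg_zero, zero_smul, zero_smul, add_zero, add_zero] at h1
  exact (smul_eq_zero.1 h1).resolve_right hw

/-- In a plane with a non-zero alternating form, the orthogonal of a line is the line itself. -/
theorem mem_submodule_iff (ℓ : ℙ ℂ W) (w : W) :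
    w ∈ ℓ.submodule ↔ ∀ u : ℓ.submodule, d.form w u = 0 := by
  rw [ℓ.submodule_eq]
  constructor
  · rintro hw ⟨u, hu⟩
    obtain ⟨t, rfl⟩ := Submodule.mem_span_singleton.1 hw
    obtain ⟨t', rfl⟩ := Submodule.mem_span_singleton.1 hu
    simp [d.form_self]
  · intro h
    have h0 := h ⟨ℓ.rep, Submodule.mem_span_singleton_self _⟩
    obtain ⟨u, hu⟩ := d.exists_form_ne_zero ℓ.rep_nonzero
    have h1 := d.form_cyclic w ℓ.rep u
    rw [h0, zero_smul, zero_add] at h1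
    refine Submodule.mem_span_singleton.2 ⟨-(d.form ℓ.rep u)⁻¹ * d.form u w, ?_⟩
    have h2 := congrArg (fun v => (d.form ℓ.rep u)⁻¹ • v) (eq_neg_of_add_eq_zero_left h1)
    rw [smul_smul, inv_mul_cancel₀ hu, one_smul] at h2
    refine Eq.trans ?_ h2.symm
    rw [neg_mul, neg_smul, smul_neg, smul_smul]

/-- Tangent vectors at equal points are identified through the model space. -/
theorem theta_congr {x y : d.X} (h : x = y) (v : Model V W) {w : W} (hx : w ∈ x.1.submodule)
    (hy : w ∈ y.1.submodule) : d.theta x v ⟨w, hx⟩ = d.theta y v ⟨w, hy⟩ := by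
  subst h
  rfl

theorem param_zero (b : Module.Basis (Fin 2) ℂ W) (z : ℂ) :
    d.param b (0, 0, 0, z) = d.basePoint (ProjLine.param b z) := by
  have h : d.nilOf b (0, 0, 0, z) = 0 := by
    ext1 <;> simp [nilOf]
  rw [param, h]
  rfl

theorem theta_basePoint (b : Module.Basis (Fin 2) ℂ W) (z : ℂ) (e' : Model V W)
    (w : (ProjLine.param b z).submodule) :
    d.theta (d.basePoint (ProjLine.param b z))
      (mfderiv 𝓘(ℂ, Model V W) 𝓘(ℂ, Model V W) (d.param b) ((0, 0, 0, z) : Model V W) e') w =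
      d.form e'.2.2.1 w := by
  have h1 := d.theta_param b (0, 0, 0, z) e' w
  have h2 : d.maurerCartan (d.nilOf b (0, 0, 0, z)) (d.nilOf b e') = e'.2.2.1 := by
    simp [maurerCartan, nilOf]
  rw [h2] at h1
  exact (d.theta_congr (d.param_zero b z).symm _ w.2 w.2).trans h1

theorem theta_velocity (ℓ : ℙ ℂ W) (Y : d.Nil) (w : ℓ.submodule) :
    d.theta (d.basePoint ℓ) (d.velocity ℓ Y) w = d.form Y.three w := by
  have hX : HasDerivAt (fun t : ℂ => t • Y) Y 0 :=
    ((hasDerivAt_id (0 : ℂ)).smul_const Y).congr_deriv (one_smul ℂ Y)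
  have h1 := (d.theta_curve hX (mdifferentiableAt_const (c := ℓ))).2 w
  have h2 : d.maurerCartan ((0 : ℂ) • Y) Y = Y.three := by
    simp [maurerCartan]
  rw [h2] at h1
  have h3 : d.basePoint ℓ = d.ξ (N.exp ((0 : ℂ) • Y)) ℓ := by
    rw [zero_smul]
    rfl
  exact (d.theta_congr h3 _ w.2 w.2).trans h1

theorem mfderiv_congr_fun {f g : ℂ → d.X} (h : f = g) (t : ℂ) :
    (mfderiv 𝓘(ℂ, ℂ) 𝓘(ℂ, Model V W) f t (1 : ℂ) : Model V W) =
      (mfderiv 𝓘(ℂ, ℂ) 𝓘(ℂ, Model V W) g t (1 : ℂ) : Model V W) := by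
  subst h
  rfl

theorem mfderiv_param_congr (b : Module.Basis (Fin 2) ℂ W) {e₁ e₂ : Model V W} (h : e₁ = e₂)
    (e' : Model V W) :
    (mfderiv 𝓘(ℂ, Model V W) 𝓘(ℂ, Model V W) (d.param b) e₁ e' : Model V W) =
      (mfderiv 𝓘(ℂ, Model V W) 𝓘(ℂ, Model V W) (d.param b) e₂ e' : Model V W) := by
  subst h
  rfl

/-- The velocities of the curves `ξ (exp (tY), ℓ)` with `Y ∈ 𝔫_m` in coordinates. -/
theorem velocity_nilOf (b : Module.Basis (Fin 2) ℂ W) (z : ℂ) (v : V) (f : StrongDual ℂ V)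
    (w : W) : (d.velocity (ProjLine.param b z) (d.nilOf b (v, f, w, 0)) : Model V W) =
      (mfderiv 𝓘(ℂ, Model V W) 𝓘(ℂ, Model V W) (d.param b) ((0, 0, 0, z) : Model V W)
        ((v, f, w, 0) : Model V W) : Model V W) := by
  have hc := hasDerivAt_line (E := Model V W) (0, 0, 0, z) (v, f, w, 0)
  have h1 := d.mfderiv_param_curve b hc
  refine Eq.trans (d.mfderiv_congr_fun (funext fun t => ?_) 0)
    (h1.trans (d.mfderiv_param_congr b (line_zero (E := Model V W) _ _) _))
  have h2 : d.nilOf b ((0, 0, 0, z) + t • (v, f, w, 0)) = t • d.nilOf b (v, f, w, 0) := by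
    ext1 <;> simp [nilOf, TensorProduct.smul_tmul']
  rw [param, h2]
  simp

/-- The differential of the section `m ↦ ξ (o, m)` of `ψ` in coordinates. -/
theorem mfderiv_section (b : Module.Basis (Fin 2) ℂ W) (z : ℂ)
    (τ : TangentSpace 𝓘(ℂ, ℂ) (ProjLine.param b z)) :
    (mfderiv 𝓘(ℂ, ℂ) 𝓘(ℂ, Model V W) (fun m : ℙ ℂ W => d.ξ 1 m) (ProjLine.param b z) τ :
        Model V W) =
      (mfderiv 𝓘(ℂ, Model V W) 𝓘(ℂ, Model V W) (d.param b) ((0, 0, 0, z) : Model V W)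
        ((0, 0, 0, mfderiv 𝓘(ℂ, ℂ) 𝓘(ℂ, ℂ) (Function.invFun (ProjLine.param b))
          (ProjLine.param b z) τ) : Model V W) : Model V W) := by
  have hinv : Function.invFun (ProjLine.param b) (ProjLine.param b z) = z :=
    Function.leftInverse_invFun (ProjLine.param_injective b) z
  have hU := (ProjLine.isOpen_range_param b).mem_nhds ⟨z, rfl⟩
  have hd1 : MDifferentiableAt 𝓘(ℂ, ℂ) 𝓘(ℂ, ℂ) (Function.invFun (ProjLine.param b))
      (ProjLine.param b z) :=
    ((ProjLine.contMDiffOn_invFun_param b).contMDiffAt hU).mdifferentiableAt (by simp)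
  obtain ⟨ι, hι⟩ : ∃ ι : ℂ →L[ℂ] Model V W, ι = (0 : ℂ →L[ℂ] V).prod
    ((0 : ℂ →L[ℂ] StrongDual ℂ V).prod ((0 : ℂ →L[ℂ] W).prod (ContinuousLinearMap.id ℂ ℂ))) :=
    ⟨_, rfl⟩
  have hι' (t : ℂ) : ι t = (0, 0, 0, t) := by rw [hι]; rfl
  have hd2 : MDifferentiableAt 𝓘(ℂ, ℂ) 𝓘(ℂ, Model V W) ι
    (Function.invFun (ProjLine.param b) (ProjLine.param b z)) :=
    ι.differentiableAt.mdifferentiableAt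
  have hd3 := d.mdifferentiableAt_param b
    (ι (Function.invFun (ProjLine.param b) (ProjLine.param b z)))
  have heq : (fun m : ℙ ℂ W => d.ξ 1 m) =ᶠ[nhds (ProjLine.param b z)]
      d.param b ∘ ι ∘ Function.invFun (ProjLine.param b) := by
    filter_upwards [hU] with m hm
    obtain ⟨t, rfl⟩ := hm
    have h1 : Function.invFun (ProjLine.param b) (ProjLine.param b t) = t :=
      Function.leftInverse_invFun (ProjLine.param_injective b) t
    rw [Function.comp_apply, Function.comp_apply, h1, hι', param_zero]
    rfl
  have h1 := mfderiv_comp_apply (ProjLine.param b z) hd3 (hd2.comp _ hd1) τ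
  have h2 := mfderiv_comp_apply (ProjLine.param b z) hd2 hd1 τ
  have h3 (t : ℂ) : mfderiv 𝓘(ℂ, ℂ) 𝓘(ℂ, Model V W) ι
      (Function.invFun (ProjLine.param b) (ProjLine.param b z)) t = ((0, 0, 0, t) : Model V W) := by
    rw [mfderiv_eq_fderiv, ι.fderiv]
    exact hι' t
  rw [heq.mfderiv_eq]
  refine h1.trans ?_
  refine Eq.trans (congrArg (mfderiv 𝓘(ℂ, Model V W) 𝓘(ℂ, Model V W) (d.param b) _)
    (h2.trans (h3 _))) (d.mfderiv_param_congr b ?_ _)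
  rw [Function.comp_apply, hinv, hι']

theorem mfderiv_invFun_param (b : Module.Basis (Fin 2) ℂ W) (z z' : ℂ) :
    mfderiv 𝓘(ℂ, ℂ) 𝓘(ℂ, ℂ) (Function.invFun (ProjLine.param b)) (ProjLine.param b z)
      (mfderiv 𝓘(ℂ, ℂ) 𝓘(ℂ, ℂ) (ProjLine.param b) z z') = z' := by
  have hU := (ProjLine.isOpen_range_param b).mem_nhds ⟨z, rfl⟩
  have h1 := mfderiv_comp_apply z
    (((ProjLine.contMDiffOn_invFun_param b).contMDiffAt hU).mdifferentiableAt (by simp))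
    ((ProjLine.contMDiff_param b z).mdifferentiableAt (by simp)) z'
  have h2 : Function.invFun (ProjLine.param b) ∘ ProjLine.param b = id :=
    funext (Function.leftInverse_invFun (ProjLine.param_injective b))
  rw [h2, mfderiv_id] at h1
  exact h1.symm

theorem contactDistribution_basePoint (ℓ : ℙ ℂ W) :
    d.contactDistribution (d.basePoint ℓ) = d.baseHyperplane ℓ := by
  obtain ⟨b, z, rfl⟩ := ProjLine.exists_basis Fact.out ℓ
  apply le_antisymm
  · intro v hv
    obtain ⟨⟨v', f', w', z'⟩, he⟩ := d.exists_mfderiv_param b (0, 0, 0, z) v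
    have hw : w' ∈ (ProjLine.param b z).submodule := by
      refine (d.mem_submodule_iff _ _).2 fun u => ?_
      rw [← d.theta_basePoint b z (v', f', w', z') u]
      refine Eq.trans ?_ ((d.mem_contactDistribution _ v).1 hv u)
      exact congrArg (fun v => d.theta (d.basePoint (ProjLine.param b z)) v u) he
    have hsplit : ((v', f', w', z') : Model V W) = (v', f', w', 0) + (0, 0, 0, z') := by simp
    have hadd := (mfderiv 𝓘(ℂ, Model V W) 𝓘(ℂ, Model V W) (d.param b)
      ((0, 0, 0, z) : Model V W)).map_add ((v', f', w', 0) : Model V W)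
      ((0, 0, 0, z') : Model V W)
    have hadd' := hadd.symm.trans ((congrArg (mfderiv 𝓘(ℂ, Model V W) 𝓘(ℂ, Model V W) (d.param b)
      ((0, 0, 0, z) : Model V W)) hsplit.symm).trans he)
    refine Submodule.mem_sup.2 ⟨d.velocity _ (d.nilOf b (v', f', w', 0)),
      Submodule.subset_span ⟨_, hw, rfl⟩, _,
      ⟨mfderiv 𝓘(ℂ, ℂ) 𝓘(ℂ, ℂ) (ProjLine.param b) z z', rfl⟩, Eq.trans ?_ hadd'⟩
    refine congrArg₂ (fun x y : Model V W => x + y) (d.velocity_nilOf b z v' f' w') ?_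
    refine (d.mfderiv_section b z _).trans ?_
    rw [mfderiv_invFun_param]
  · refine sup_le (Submodule.span_le.2 ?_) ?_
    · rintro _ ⟨Y, hY, rfl⟩
      refine (d.mem_contactDistribution _ _).2 fun w => ?_
      exact (d.theta_velocity _ Y w).trans ((d.mem_submodule_iff _ _).1 hY w)
    · rintro _ ⟨τ, rfl⟩
      refine (d.mem_contactDistribution _ _).2 fun w => ?_
      have h1 := congrArg (fun v => d.theta (d.basePoint (ProjLine.param b z)) v w)
        (d.mfderiv_section b z τ)
      refine h1.trans ((d.theta_basePoint b z _ w).trans ?_)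
      simp

/-! ### Holomorphy of `theta` -/

theorem coe_eq_cofun_smul (b : Module.Basis (Fin 2) ℂ W) (z : ℂ)
    (w : (ProjLine.param b z).submodule) :
    (w : W) = cofun b (ProjLine.param b z) w • (b 0 + z • b 1) := by
  have h1 := congrArg (Subtype.val) (eq_smul_gen b (ProjLine.param b z) ⟨z, rfl⟩ w)
  rw [← gen_param b z]
  exact h1

theorem theta_param_eq_contactForm (b : Module.Basis (Fin 2) ℂ W) (e e' : Model V W)
    (w : (ProjLine.param b e.2.2.2).submodule) :
    d.theta (d.param b e) (mfderiv 𝓘(ℂ, Model V W) 𝓘(ℂ, Model V W) (d.param b) e e') w =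
      cofun b (ProjLine.param b e.2.2.2) w * d.contactForm b e e' := by
  refine (d.theta_param b e e' w).trans ?_
  rw [coe_eq_cofun_smul b e.2.2.2 w, map_smul, smul_eq_mul, contactForm_eq_maurerCartan]

/-- The contraction of `theta` with the section `l + z m` of the tautological bundle is the contact
form in the coordinates given by `b = (l, m)`. -/
theorem theta_gen (b : Module.Basis (Fin 2) ℂ W) {x : d.X} (hx : x ∈ Set.range (d.param b))
    (v : TangentSpace 𝓘(ℂ, Model V W) x) :
    d.theta x v (gen b x.1) = d.contactForm b (d.chartMap b x)
      (mfderiv 𝓘(ℂ, Model V W) 𝓘(ℂ, Model V W) (d.chartMap b) x v) := by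
  obtain ⟨e, rfl⟩ := hx
  obtain ⟨e', rfl⟩ := d.exists_mfderiv_param b e v
  refine (d.theta_param_eq_contactForm b e e' _).trans ?_
  rw [mfderiv_chartMap_param, chartMap_param]
  refine Eq.trans ?_ (one_mul _)
  exact congrArg (· * _) (cofun_gen_self b (ProjLine.param b e.2.2.2) ⟨_, rfl⟩)

/-- Contraction of `theta` with a local generator of the tautological bundle is a holomorphic
1-form. -/
theorem contMDiffOn_theta_gen (b : Module.Basis (Fin 2) ℂ W) :
    ContMDiffOn 𝓘(ℂ, Model V W).tangent 𝓘(ℂ, ℂ) ω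
      (fun v : TangentBundle 𝓘(ℂ, Model V W) d.X => d.theta v.proj v.2 (gen b v.proj.1))
      {v | v.proj ∈ Set.range (d.param b)} := by
  have ho := d.isOpen_range_param b
  have h1 := (d.contMDiffOn_chartMap b).contMDiffOn_tangentMapWithin (m := ω) le_rfl
    ho.uniqueMDiffOn
  have h2 := (contMDiff_snd_tangentBundle_modelSpace (Model V W) 𝓘(ℂ, Model V W)
    (n := ω)).comp_contMDiffOn h1
  have h3 := (Bundle.contMDiff_proj (IB := 𝓘(ℂ, Model V W)) (n := ω) (F := Model V W)
    (TangentSpace 𝓘(ℂ, Model V W) (M := Model V W))).comp_contMDiffOn h1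
  have h4 := (d.contDiff_contactForm_apply b).contMDiff.comp_contMDiffOn (h3.prodMk_space h2)
  refine h4.congr ?_
  rintro ⟨x, v⟩ hx
  refine (d.theta_gen b hx v).trans ?_
  rw [← mfderivWithin_of_isOpen (f := d.chartMap b) ho hx]
  rfl

theorem theta_surjective (x : d.X) : Function.Surjective (d.theta x) := by
  obtain ⟨b, e, rfl⟩ : ∃ b, x ∈ Set.range (d.param b) := ⟨_, d.atlas.mem_range x⟩
  intro l
  obtain ⟨u, hu⟩ := d.exists_form_ne_zero (ProjLine.vec_ne_zero b e.2.2.2)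
  obtain ⟨t, ht⟩ : ∃ t : ℂ, t = l (gen b (ProjLine.param b e.2.2.2)) *
    (-(d.form (b 0 + e.2.2.2 • b 1) u)⁻¹) := ⟨_, rfl⟩
  refine ⟨mfderiv 𝓘(ℂ, Model V W) 𝓘(ℂ, Model V W) (d.param b) e ((0, 0, t • u, 0) : Model V W),
    ContinuousLinearMap.ext fun w => ?_⟩
  refine (d.theta_param_eq_contactForm b e _ w).trans ?_
  have h1 : d.contactForm b e ((0, 0, t • u, 0) : Model V W) =
      l (gen b (ProjLine.param b e.2.2.2)) := by
    rw [contactForm_apply]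
    simp only [map_smul, LinearMap.smul_apply, d.form_swap u, ht, smul_eq_mul, map_zero,
      zero_apply]
    field_simp
    simp
  rw [h1]
  have h2 := eq_smul_gen b (ProjLine.param b e.2.2.2) ⟨_, rfl⟩ w
  exact ((congrArg l h2).trans (map_smul l _ _)).symm

theorem quotientIsoL_contactDistribution : d.QuotientIsoL d.contactDistribution := by
  refine ⟨d.theta, fun v₀ => ?_, fun x => ⟨d.theta_surjective x, rfl⟩⟩
  refine Bundle.contMDiffAt_totalSpace.2 ⟨(Bundle.contMDiff_proj _) v₀, ?_⟩
  -- The trivialization of `L` at this point is evaluation on the generator for this basis.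
  obtain ⟨b, hb⟩ : ∃ b, b = (ProjLine.exists_basis (W := W) Fact.out v₀.proj.1).choose := ⟨_, rfl⟩
  have hmem : v₀.proj.1 ∈ Set.range (ProjLine.param b) := by
    rw [hb]
    exact (ProjLine.exists_basis (W := W) Fact.out v₀.proj.1).choose_spec
  have hx := d.exists_param b v₀.proj hmem
  have ho : IsOpen {v : TangentBundle 𝓘(ℂ, Model V W) d.X | v.proj ∈ Set.range (d.param b)} :=
    (d.isOpen_range_param b).preimage (FiberBundle.continuous_proj _ _)
  refine ((d.contMDiffOn_theta_gen b).contMDiffAt (ho.mem_nhds hx)).congr_of_eventuallyEq ?_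
  rw [hb]
  exact Filter.Eventually.of_forall fun v => rfl

/-! ### Non-degeneracy -/

/-- The exterior derivative of the contact form is non-degenerate on its kernel. -/
theorem eq_zero_of_contactFormLin (b : Module.Basis (Fin 2) ℂ W) (e u : Model V W)
    (hu : d.contactForm b e u = 0)
    (h : ∀ v : Model V W, d.contactForm b e v = 0 →
      d.contactFormLin b u v - d.contactFormLin b v u = 0) : u = 0 := by
  obtain ⟨v₁, f₁, w₁, z₁⟩ := u
  obtain ⟨l, hl⟩ : ∃ l, l = b 0 + e.2.2.2 • b 1 := ⟨_, rfl⟩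
  have hl0 : l ≠ 0 := by
    rw [hl]
    exact ProjLine.vec_ne_zero b _
  have hml : d.form (b 1) l = d.form (b 1) (b 0) := by
    rw [hl, map_add, map_smul, d.form_self, smul_zero, add_zero]
  have hm0 : d.form (b 1) (b 0) ≠ 0 := by
    intro h0
    obtain ⟨x, hx⟩ := d.exists_form_ne_zero (b.ne_zero 1)
    apply hx
    rw [← b.sum_repr x, Fin.sum_univ_two, map_add, map_smul, map_smul, h0, d.form_self]
    simp
  have hlm : d.form l (b 1) ≠ 0 := by
    rw [d.form_swap, hml]
    exact neg_ne_zero.2 hm0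
  simp only [contactForm_apply, ← hl, contactFormLin_apply] at hu h
  -- The vector `(0, 0, l, 0)` lies in the kernel and pairs with `u` to `z₁ ω(l, m)`.
  have hz : z₁ = 0 := by
    have h1 := h (0, 0, l, 0) (by simp [d.form_self])
    simpa [hlm] using h1
  subst hz
  have hw : d.form w₁ (b 1) = 0 := by
    have h1 := h (0, 0, 0, 1) (by simp)
    simpa using h1
  have hv : v₁ = 0 := by
    by_contra hv
    obtain ⟨f, hf⟩ : ∃ f : StrongDual ℂ V, f v₁ ≠ 0 := by
      by_contra! hf
      exact hv ((SeparatingDual.eq_zero_iff_forall_dual_eq_zero (R := ℂ) v₁).2 hf)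
    -- The component `t m` makes the test vector lie in the kernel, and it does not contribute to
    -- the pairing with `u`.
    obtain ⟨t, ht⟩ : ∃ t : ℂ, t = -(1 / 2) * f e.1 := ⟨_, rfl⟩
    have h1 := h (0, f, t • b 1, 0) (by simp [hml, ht])
    simp only [map_zero, zero_mul] at h1
    have h2 : f v₁ * d.form (b 1) (b 0) = 0 := by linear_combination h1
    exact (mul_ne_zero hf hm0) h2
  subst hv
  have hf : f₁ = 0 := by
    ext v
    obtain ⟨t, ht⟩ : ∃ t : ℂ, t = (1 / 2) * e.2.1 v := ⟨_, rfl⟩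
    have h1 := h (v, 0, t • b 1, 0) (by simp [hml, ht])
    simp only [map_zero, zero_mul] at h1
    have h2 : f₁ v * d.form (b 1) (b 0) = 0 := by linear_combination -h1
    exact (mul_eq_zero.1 h2).resolve_right hm0
  subst hf
  have hw1 : w₁ = 0 := by
    by_contra hw0
    have hwl : d.form w₁ l = 0 := by simpa using hu
    have h1 := d.form_cyclic l (b 1) w₁
    rw [d.form_swap (b 1) w₁, hw, hwl, neg_zero, zero_smul, zero_smul, add_zero, add_zero] at h1
    exact hw0 ((smul_eq_zero.1 h1).resolve_left hlm)
  subst hw1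
  rfl

/-- Since the fibres of the tautological bundle are lines, membership in the distribution may be
tested on a generator. -/
theorem mem_contactDistribution_iff_gen (b : Module.Basis (Fin 2) ℂ W) {x : d.X}
    (hx : x ∈ Set.range (d.param b)) (v : TangentSpace 𝓘(ℂ, Model V W) x) :
    v ∈ d.contactDistribution x ↔ d.theta x v (gen b x.1) = 0 := by
  refine (d.mem_contactDistribution x v).trans ⟨fun h => h _, fun h w => ?_⟩
  have h1 := congrArg (d.theta x v) (eq_smul_gen b x.1 (d.fst_mem_range b hx) w)
  refine h1.trans ((map_smul _ _ _).trans ?_)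
  rw [h, smul_zero]

theorem mfderiv_chartMap_bijective (b : Module.Basis (Fin 2) ℂ W) {x : d.X}
    (hx : x ∈ Set.range (d.param b)) : Function.Bijective
      (mfderiv 𝓘(ℂ, Model V W) 𝓘(ℂ, Model V W) (d.chartMap b) x) := by
  obtain ⟨e, rfl⟩ := hx
  refine ⟨fun u v h => ?_, fun e' => ⟨_, d.mfderiv_chartMap_param b e e'⟩⟩
  obtain ⟨u', rfl⟩ := d.exists_mfderiv_param b e u
  obtain ⟨v', rfl⟩ := d.exists_mfderiv_param b e v
  rw [mfderiv_chartMap_param, mfderiv_chartMap_param] at h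
  rw [h]

/-- The 1-form obtained from `theta` by contraction with the local section of the tautological
bundle given by `b`. -/
def localForm (b : Module.Basis (Fin 2) ℂ W) : OneForm (Model V W) d.X :=
  fun x => (ContinuousLinearMap.apply ℂ ℂ (gen b x.1)).comp (d.theta x)

/-- In the chart at a point, given by a basis which may differ from `b`, the form `localForm b` is
the contact form multiplied by a transition function of `𝒪(1)`. -/
theorem localForm_inChart [FiniteDimensional ℂ W] (b : Module.Basis (Fin 2) ℂ W) (x : d.X) :
    (d.localForm b).inChart x = fun q : Model V W =>
      cofun (d.atlas.idx x) (ProjLine.param (d.atlas.idx x) q.2.2.2)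
        (gen b (ProjLine.param (d.atlas.idx x) q.2.2.2)) •
      affineForm (E := Model V W) (d.contactFormConst (d.atlas.idx x))
        (d.contactFormLin (d.atlas.idx x)) q := by
  funext q
  exact ContinuousLinearMap.ext fun e' =>
    d.theta_param_eq_contactForm (d.atlas.idx x) q e' _

theorem cofun_gen_ne_zero (b b' : Module.Basis (Fin 2) ℂ W) {ℓ : ℙ ℂ W}
    (h : ℓ ∈ Set.range (ProjLine.param b)) (h' : ℓ ∈ Set.range (ProjLine.param b')) :
    cofun b' ℓ (gen b ℓ) ≠ 0 := by
  intro h0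
  have h1 := eq_smul_gen b' ℓ h' (gen b ℓ)
  rw [h0, zero_smul] at h1
  have h2 := cofun_gen_self b ℓ h
  rw [h1, map_zero] at h2
  exact zero_ne_one h2

theorem differentiableAt_cofun_gen (b b' : Module.Basis (Fin 2) ℂ W) {q : Model V W}
    (h : ProjLine.param b' q.2.2.2 ∈ Set.range (ProjLine.param b)) :
    DifferentiableAt ℂ (fun q : Model V W => cofun b' (ProjLine.param b' q.2.2.2)
      (gen b (ProjLine.param b' q.2.2.2))) q := by
  have h1 := ((contMDiffOn_gen b' b).contMDiffAt
    ((ProjLine.isOpen_range_param b).mem_nhds h)).mdifferentiableAt (by simp)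
  have h2 := (ProjLine.contMDiff_param b').comp
    (ContDiff.contMDiff (show ContDiff ℂ ω fun q : Model V W => q.2.2.2 by fun_prop))
  exact mdifferentiableAt_iff_differentiableAt.1
    (h1.comp q ((h2 q).mdifferentiableAt (by simp)))

theorem isContactStructure_contactDistribution : IsContactStructure d.contactDistribution := by
  intro x₀
  obtain ⟨b, hb⟩ : ∃ b, x₀ ∈ Set.range (d.param b) := ⟨_, d.atlas.mem_range x₀⟩
  refine ⟨Set.range (d.param b), d.isOpen_range_param b, hb, d.localForm b,
    d.contMDiffOn_theta_gen b, fun x hx => ⟨fun h0 => ?_, ?_, fun u hu hdu => ?_⟩⟩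
  · obtain ⟨v, hv⟩ := d.theta_surjective x (cofun b x.1)
    have h1 := cofun_gen_self b x.1 (d.fst_mem_range b hx)
    rw [← hv] at h1
    exact zero_ne_one ((congrArg (fun l => l v) h0).symm.trans h1)
  · ext v
    exact d.mem_contactDistribution_iff_gen b hx v
  have : FiniteDimensional ℂ W := finiteDimensional_plane
  have hx' : x ∈ Set.range (d.param (d.atlas.idx x)) := d.atlas.mem_range x
  have hpx := d.param_chartMap _ hx'
  have hp : ProjLine.param (d.atlas.idx x) (d.chartMap (d.atlas.idx x) x).2.2.2 ∈
      Set.range (ProjLine.param b) := by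
    have h1 : ProjLine.param (d.atlas.idx x) (d.chartMap (d.atlas.idx x) x).2.2.2 = x.1 :=
      congrArg Sigma.fst hpx
    rw [h1]
    exact d.fst_mem_range b hx
  have hmem (v : TangentSpace 𝓘(ℂ, Model V W) x) : v ∈ d.contactDistribution x ↔
      d.contactForm (d.atlas.idx x) (d.chartMap (d.atlas.idx x) x)
        (mfderiv 𝓘(ℂ, Model V W) 𝓘(ℂ, Model V W) (d.chartMap (d.atlas.idx x)) x v) = 0 := by
    rw [d.mem_contactDistribution_iff_gen _ hx', d.theta_gen _ hx']
  obtain ⟨hinj, hsurj⟩ := d.mfderiv_chartMap_bijective _ hx'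
  refine hinj (Eq.trans ?_ (ContinuousLinearMap.map_zero _).symm)
  refine d.eq_zero_of_contactFormLin _ _ _ ((hmem u).1 hu) fun v' hv' => ?_
  obtain ⟨v, rfl⟩ := hsurj v'
  have h1 := hdu v ((hmem v).2 hv')
  have h2 := fderiv_smul_affineForm (E := Model V W) (d.contactFormConst (d.atlas.idx x))
    (d.contactFormLin (d.atlas.idx x)) (differentiableAt_cofun_gen b (d.atlas.idx x) hp)
    ((hmem u).1 hu) hv'
  rw [← d.localForm_inChart b x] at h2
  exact (mul_eq_zero.1 (h2.symm.trans h1)).resolve_left (cofun_gen_ne_zero b _ hp ⟨_, rfl⟩)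

end Contact

end CubicData

end

theorem proposition3 {V W : Type*} [NormedAddCommGroup V] [NormedSpace ℂ V]
    [FiniteDimensional ℂ V] [NormedAddCommGroup W] [NormedSpace ℂ W]
    [Fact (Module.finrank ℂ W = 2)] (d : CubicData V W) (hB : d.BSurjective) (ℓ : ℙ ℂ W) :
    ∃ D : TangentDistribution (CubicData.Model V W) d.X,
      (d.IsInvariant D ∧ D (d.basePoint ℓ) = d.baseHyperplane ℓ) ∧
      (∀ D' : TangentDistribution (CubicData.Model V W) d.X,
        d.IsInvariant D' → D' (d.basePoint ℓ) = d.baseHyperplane ℓ → D' = D) ∧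
      IsContactStructure D ∧ d.QuotientIsoL D :=
  ⟨d.contactDistribution,
    ⟨d.isInvariant_contactDistribution, d.contactDistribution_basePoint ℓ⟩,
    fun _ hD' h => d.eq_of_isInvariant d.isInvariant_contactDistribution hD' ℓ
      (h.trans (d.contactDistribution_basePoint ℓ).symm),
    d.isContactStructure_contactDistribution, d.quotientIsoL_contactDistribution⟩
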